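/- **Setting.** Let $Q$ be a smooth manifold and let $\tau_E:E\to Q$ be a vector bundle with a Lie algebroid structure $([\![\cdot,\cdot]\!],\rho)$. Consider a mechanical system subjected to affine nonholonomic constraints on $E$, that is: a vector subbundle $U\subseteq E$; a (positive definite) bundle metric $\mathcal G$ on $E$, with orthogonal projector $\mathcal P:E=U\oplus U^\perp\to U$; a function $\mathbb V\in C^\infty(Q)$; and a section $X_0\in\Gamma(E)$ with $\mathcal P(X_0)=0$. Let $\mathcal U\to Q$ be the affine bundle with fibres $\mathcal U_q=X_0(q)+U_q$, let $\mathcal U^+$ be its affine dual (the fibre $\mathcal U^+_q$ is the space of affine functions on $\mathcal U_q$), and let $$\widetilde{\mathcal U}=(\mathcal U^+)^*,\qquad \widetilde{\mathcal U}_q=\{(\lambda,\lambda X_0(q)+u)\mid \lambda\in\mathbb R,\ u\in U_q\}\subseteq\mathbb R\times E_q .$$ Let $\widetilde{\mathcal P}:\mathbb R\times E\to\widetilde{\mathcal U}$, $\widetilde{\mathcal P}(\lambda,e)=(\lambda,\lambda X_0+\mathcal P(e))$. The bundle $\widetilde{\mathcal U}$ carries the skew-symmetric algebroid structure with anchor $\rho_{\widetilde{\mathcal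 U}}(f,fX_0+\sigma)=\rho(fX_0+\sigma)$ and bracket $$[\![(f_1,s_1),(f_2,s_2)]\!]_{\widetilde{\mathcal U}}=\widetilde{\mathcal P}\bigl(\rho(s_1)(f_2)-\rho(s_2)(f_1),\,[\![s_1,s_2]\!]\bigr),\qquad s_k=f_kX_0+\sigma_k,\ f_k\in C^\infty(Q),\ \sigma_k\in\Gamma(U),$$ and $U$ carries the skew-symmetric algebroid structure with anchor $\rho_U=\rho|_U$ and bracket $[\![\sigma_1,\sigma_2]\!]_U=\mathcal P([\![\sigma_1,\sigma_2]\!])$. For $\beta\in\Gamma(\mathcal U^+)=\Gamma(\widetilde{\mathcal U}^*)$ and $s,t\in\Gamma(\widetilde{\mathcal U})$ put $$d^{\widetilde{\mathcal U}}\beta(s,t)=\rho_{\widetilde{\mathcal U}}(s)(\beta(t))-\rho_{\widetilde{\mathcal U}}(t)(\beta(s))-\beta([\![s,t]\!]_{\widetilde{\mathcal U}}).$$ Let $\mu:\mathcal U^+\to U^*$, $\mu(a)(u)=a(0,u)$, let $\tau_{U^*}:U^*\to Q$ and $\tau:\mathcal U^+\to Q$ be the bundle projections, let $\phi\in\Gamma(\mathcal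 U^+)$ be given by $\phi(\lambda,\lambda X_0+u)=\lambda$, and let $$H:U^*\to\mathbb R,\qquad H(\eta_q)=\tfrac12\mathcal G_{U^*}(\eta_q,\eta_q)+\mathbb V(q),$$ where $\mathcal G_{U^*}$ is the bundle metric on $U^*$ induced by $\mathcal G$. The Hamiltonian section $h:U^*\to\mathcal U^+$ is $h(\eta)(\lambda,\lambda X_0+u)=\eta(u)-\lambda H(\eta)$, and $F_h\in C^\infty(\mathcal U^+)$ is the function with $a-h(\mu(a))=F_h(a)\,\phi(\tau(a))$ for all $a\in\mathcal U^+$. Let $\{\cdot,\cdot\}$ be the linear almost Poisson bracket on $C^\infty(\mathcal U^+)$: the skew-symmetric $\mathbb R$-bilinear bracket that is a derivation in each argument and satisfies $$\{\widehat s,\widehat t\}=-\widehat{[\![s,t]\!]_{\widetilde{\mathcal U}}},\qquad \{f\circ\tau,\widehat s\}=\rho_{\widetilde{\mathcal U}}(s)(f)\circ\tau,\qquad \{f\circ\tau,g\circ\tau\}=0$$ for $s,t\in\Gamma(\widetilde{\mathcal U})$ and $f,g\in C^\infty(Q)$, where $\widehat s$ is the fibrewise linear function on $\mathcal U^+$ defined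 by $s$. The Hamiltonian vector field $R_h\in\mathfrak X(U^*)$ is the vector field with $R_h(\Phi)\circ\mu=\{\Phi\circ\mu,F_h\}$ for all $\Phi\in C^\infty(U^*)$; its integral curves are the solutions of the Hamilton equations. A distribution $\mathcal D$ on $Q$ (a choice of subspaces $\mathcal D_q\subseteq T_qQ$) is completely nonholonomic if the vector fields $X_1,\ [X_1,X_2],\ [X_1,[X_2,X_3]],\dots$, where the $X_j$ are smooth vector fields on $Q$ with $X_j(q)\in\mathcal D_q$ for all $q$, span $T_qQ$ at each point $q\in Q$. **Corollary.** Suppose that $Q$ is connected and that the distribution $\mathcal V$, $\mathcal V_q=\rho_U(U_q)$, is completely nonholonomic. Let $\beta$ be a section of $\mathcal U^+$ with $d^{\widetilde{\mathcal U}}\beta=0$. Then the following statements are equivalent: 1. For every integral curve $c:I\to Q$ ($I\subseteq\mathbb R$ an open interval) of the vector field $R_h^{\mu\circ\beta}=T\tau_{U^*}\circ R_h\circ\mu\circ\beta$ on $Q$, the curve $\mu\circ\beta\circ c:I\to U^*$ is an integral curve of $R_h$, i.e. a solution of the Hamilton equations. 2. The function $H\circ\mu\circ\beta+\beta(1,X_0)$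 is constant on $Q$. -/

import Mathlib

open Bundle Manifold ContDiff

noncomputable section

set_option linter.unusedSectionVars false

namespace AffineHJ

/-! ### Vector bundle morphisms, sections, distributions -/

section Basics

variable {EQ : Type*} [NormedAddCommGroup EQ] [NormedSpace ℝ EQ]
  {Q : Type*} [TopologicalSpace Q] [ChartedSpace EQ Q]

/-- The derivative `v(f)` of a real function `f` on `Q` along a tangent vector `v`. -/
def dirDeriv (f : Q → ℝ) (q : Q) (v : TangentSpace 𝓘(ℝ, EQ) q) : ℝ :=
  mfderiv 𝓘(ℝ, EQ) 𝓘(ℝ, ℝ) f q v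

/-- A smooth vector bundle morphism `E₁ → E₂` over the identity of `Q`. -/
structure BundleMap (EQ : Type*) [NormedAddCommGroup EQ] [NormedSpace ℝ EQ]
    {Q : Type*} [TopologicalSpace Q] [ChartedSpace EQ Q]
    (F₁ : Type*) [NormedAddCommGroup F₁] [NormedSpace ℝ F₁]
    (E₁ : Q → Type*) [TopologicalSpace (TotalSpace F₁ E₁)] [∀ q, TopologicalSpace (E₁ q)]
    [∀ q, AddCommGroup (E₁ q)] [∀ q, Module ℝ (E₁ q)] [FiberBundle F₁ E₁]
    (F₂ : Type*) [NormedAddCommGroup F₂] [NormedSpace ℝ F₂]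
    (E₂ : Q → Type*) [TopologicalSpace (TotalSpace F₂ E₂)] [∀ q, TopologicalSpace (E₂ q)]
    [∀ q, AddCommGroup (E₂ q)] [∀ q, Module ℝ (E₂ q)] [FiberBundle F₂ E₂] where
  /-- the linear map between the fibres over `q` -/
  toFun : ∀ q, E₁ q →ₗ[ℝ] E₂ q
  smooth : ContMDiff (𝓘(ℝ, EQ).prod 𝓘(ℝ, F₁)) (𝓘(ℝ, EQ).prod 𝓘(ℝ, F₂)) ∞
    (fun p : TotalSpace F₁ E₁ => (⟨p.1, toFun p.1 p.2⟩ : TotalSpace F₂ E₂))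

variable [IsManifold 𝓘(ℝ, EQ) ∞ Q]

/-- The vector fields `X₁, [X₁, X₂], [X₁, [X₂, X₃]], …` where every `Xⱼ` is a smooth vector field
on `Q` with values in `D`. -/
inductive IteratedBracket (D : ∀ q : Q, Submodule ℝ (TangentSpace 𝓘(ℝ, EQ) q)) :
    (∀ q : Q, TangentSpace 𝓘(ℝ, EQ) q) → Prop
  | base (X : ∀ q : Q, TangentSpace 𝓘(ℝ, EQ) q)
      (hX : ContMDiff 𝓘(ℝ, EQ) 𝓘(ℝ, EQ).tangent ∞
        (fun q => (⟨q, X q⟩ : TangentBundle 𝓘(ℝ, EQ) Q)))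
      (hD : ∀ q, X q ∈ D q) : IteratedBracket D X
  | lie (X Y : ∀ q : Q, TangentSpace 𝓘(ℝ, EQ) q)
      (hX : ContMDiff 𝓘(ℝ, EQ) 𝓘(ℝ, EQ).tangent ∞
        (fun q => (⟨q, X q⟩ : TangentBundle 𝓘(ℝ, EQ) Q)))
      (hD : ∀ q, X q ∈ D q) (hY : IteratedBracket D Y) :
      IteratedBracket D (VectorField.mlieBracket 𝓘(ℝ, EQ) X Y)

/-- `D` is completely nonholonomic (bracket generating). -/
def CompletelyNonholonomic (D : ∀ q : Q, Submodule ℝ (TangentSpace 𝓘(ℝ, EQ) q)) : Prop :=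
  ∀ q, Submodule.span ℝ {v | ∃ Y, IteratedBracket D Y ∧ Y q = v} = ⊤

end Basics

section OneBundle

variable {EQ : Type*} [NormedAddCommGroup EQ] [NormedSpace ℝ EQ]
  {Q : Type*} [TopologicalSpace Q] [ChartedSpace EQ Q]
  {F : Type*} [NormedAddCommGroup F] [NormedSpace ℝ F]
  {E : Q → Type*} [TopologicalSpace (TotalSpace F E)] [∀ q, TopologicalSpace (E q)]
  [∀ q, AddCommGroup (E q)] [∀ q, Module ℝ (E q)] [FiberBundle F E] [VectorBundle ℝ F E]

/-- The product `f σ` of a smooth function and a smooth section. -/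
def smulSection (f : C^∞⟮𝓘(ℝ, EQ), Q; ℝ⟯) (σ : Cₛ^∞⟮𝓘(ℝ, EQ); F, E⟯) :
    Cₛ^∞⟮𝓘(ℝ, EQ); F, E⟯ :=
  ⟨fun q => f q • σ q, f.contMDiff.smul_section σ.contMDiff⟩

/-- The section `T ∘ σ` of `E₂` for a bundle morphism `T : E₁ → E₂` and a section `σ` of `E₁`. -/
def BundleMap.mapSection {F₂ : Type*} [NormedAddCommGroup F₂] [NormedSpace ℝ F₂]
    {E₂ : Q → Type*} [TopologicalSpace (TotalSpace F₂ E₂)] [∀ q, TopologicalSpace (E₂ q)]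
    [∀ q, AddCommGroup (E₂ q)] [∀ q, Module ℝ (E₂ q)] [FiberBundle F₂ E₂]
    (T : BundleMap EQ F E F₂ E₂) (σ : Cₛ^∞⟮𝓘(ℝ, EQ); F, E⟯) : Cₛ^∞⟮𝓘(ℝ, EQ); F₂, E₂⟯ :=
  ⟨fun q => T.toFun q (σ q), T.smooth.comp σ.contMDiff⟩

end OneBundle

/-! ### Skew-symmetric algebroids -/

section Algebroid

/-- A skew-symmetric algebroid structure on the vector bundle `E → Q`. -/
structure SkewAlgebroid (EQ : Type*) [NormedAddCommGroup EQ] [NormedSpace ℝ EQ]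
    {Q : Type*} [TopologicalSpace Q] [ChartedSpace EQ Q] [IsManifold 𝓘(ℝ, EQ) ∞ Q]
    (F : Type*) [NormedAddCommGroup F] [NormedSpace ℝ F]
    (E : Q → Type*) [TopologicalSpace (TotalSpace F E)] [∀ q, TopologicalSpace (E q)]
    [∀ q, AddCommGroup (E q)] [∀ q, Module ℝ (E q)] [FiberBundle F E] [VectorBundle ℝ F E] where
  /-- the anchor map `ρ : E → TQ` -/
  anchor : BundleMap EQ F E EQ (TangentSpace 𝓘(ℝ, EQ) : Q → Type _)
  /-- the bracket on the space of smooth sections -/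
  bracket : Cₛ^∞⟮𝓘(ℝ, EQ); F, E⟯ → Cₛ^∞⟮𝓘(ℝ, EQ); F, E⟯ → Cₛ^∞⟮𝓘(ℝ, EQ); F, E⟯
  bracket_add : ∀ σ γ δ, bracket σ (γ + δ) = bracket σ γ + bracket σ δ
  bracket_smul : ∀ (c : ℝ) σ γ, bracket σ (c • γ) = c • bracket σ γ
  bracket_skew : ∀ σ γ, bracket σ γ = -bracket γ σ
  leibniz : ∀ (σ γ : Cₛ^∞⟮𝓘(ℝ, EQ); F, E⟯) (f : C^∞⟮𝓘(ℝ, EQ), Q; ℝ⟯) (q : Q),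
    bracket σ (smulSection f γ) q
      = f q • bracket σ γ q + dirDeriv f q (anchor.toFun q (σ q)) • γ q

/-- A Lie algebroid structure on `E → Q`. -/
structure LieAlgebroid (EQ : Type*) [NormedAddCommGroup EQ] [NormedSpace ℝ EQ]
    {Q : Type*} [TopologicalSpace Q] [ChartedSpace EQ Q] [IsManifold 𝓘(ℝ, EQ) ∞ Q]
    (F : Type*) [NormedAddCommGroup F] [NormedSpace ℝ F]
    (E : Q → Type*) [TopologicalSpace (TotalSpace F E)] [∀ q, TopologicalSpace (E q)]
    [∀ q, AddCommGroup (E q)] [∀ q, Module ℝ (E q)] [FiberBundle F E] [VectorBundle ℝ F E]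
    extends SkewAlgebroid EQ F E where
  jacobi : ∀ σ γ δ, bracket σ (bracket γ δ)
    = bracket (bracket σ γ) δ + bracket γ (bracket σ δ)

namespace SkewAlgebroid

variable {EQ : Type*} [NormedAddCommGroup EQ] [NormedSpace ℝ EQ]
  {Q : Type*} [TopologicalSpace Q] [ChartedSpace EQ Q] [IsManifold 𝓘(ℝ, EQ) ∞ Q]
  {F : Type*} [NormedAddCommGroup F] [NormedSpace ℝ F]
  {E : Q → Type*} [TopologicalSpace (TotalSpace F E)] [∀ q, TopologicalSpace (E q)]
  [∀ q, AddCommGroup (E q)] [∀ q, Module ℝ (E q)] [FiberBundle F E] [VectorBundle ℝ F E]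
  (A : SkewAlgebroid EQ F E)

lemma contMDiff_deriv (σ : Cₛ^∞⟮𝓘(ℝ, EQ); F, E⟯) (f : C^∞⟮𝓘(ℝ, EQ), Q; ℝ⟯) :
    ContMDiff 𝓘(ℝ, EQ) 𝓘(ℝ, ℝ) ∞
      (fun q => dirDeriv f q (A.anchor.toFun q (σ q))) := by
  have h1 := f.contMDiff.contMDiff_tangentMap (m := ∞) (by simp)
  have h2 := (A.anchor.mapSection σ).contMDiff
  exact (contMDiff_snd_tangentBundle_modelSpace ℝ 𝓘(ℝ, ℝ)).comp (h1.comp h2)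

lemma _root_.AffineHJ.dirDeriv_add (f g : C^∞⟮𝓘(ℝ, EQ), Q; ℝ⟯) (q : Q)
    (v : TangentSpace 𝓘(ℝ, EQ) q) :
    dirDeriv (f + g : C^∞⟮𝓘(ℝ, EQ), Q; ℝ⟯) q v = dirDeriv f q v + dirDeriv g q v := by
  have := mfderiv_add (I := 𝓘(ℝ, EQ)) (f.contMDiff.mdifferentiable (by simp) q)
    (g.contMDiff.mdifferentiable (by simp) q)
  exact congrArg (fun L : EQ →L[ℝ] ℝ => L v) this

lemma _root_.AffineHJ.dirDeriv_mul (f g : C^∞⟮𝓘(ℝ, EQ), Q; ℝ⟯) (q : Q)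
    (v : TangentSpace 𝓘(ℝ, EQ) q) :
    dirDeriv (f * g : C^∞⟮𝓘(ℝ, EQ), Q; ℝ⟯) q v = f q * dirDeriv g q v + g q * dirDeriv f q v := by
  have h := (f.contMDiff.mdifferentiable (by simp) q).hasMFDerivAt.mul
    (g.contMDiff.mdifferentiable (by simp) q).hasMFDerivAt
  exact congrArg (fun L : EQ →L[ℝ] ℝ => L v) h.mfderiv

lemma _root_.AffineHJ.dirDeriv_map_add (f : Q → ℝ) (q : Q) (v w : TangentSpace 𝓘(ℝ, EQ) q) :
    dirDeriv f q (v + w) = dirDeriv f q v + dirDeriv f q w :=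
  map_add (mfderiv 𝓘(ℝ, EQ) 𝓘(ℝ, ℝ) f q) v w

lemma _root_.AffineHJ.dirDeriv_map_smul (f : Q → ℝ) (q : Q) (c : ℝ)
    (v : TangentSpace 𝓘(ℝ, EQ) q) : dirDeriv f q (c • v) = c * dirDeriv f q v :=
  map_smul (mfderiv 𝓘(ℝ, EQ) 𝓘(ℝ, ℝ) f q) c v

lemma _root_.AffineHJ.dirDeriv_smul (c : ℝ) (f : C^∞⟮𝓘(ℝ, EQ), Q; ℝ⟯) (q : Q)
    (v : TangentSpace 𝓘(ℝ, EQ) q) :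
    dirDeriv (c • f : C^∞⟮𝓘(ℝ, EQ), Q; ℝ⟯) q v = c * dirDeriv f q v := by
  have := const_smul_mfderiv (I := 𝓘(ℝ, EQ)) (f.contMDiff.mdifferentiable (by simp) q) c
  exact congrArg (fun L : EQ →L[ℝ] ℝ => L v) this

/-- The function `ρ(σ)(f)`. -/
def deriv (σ : Cₛ^∞⟮𝓘(ℝ, EQ); F, E⟯) (f : C^∞⟮𝓘(ℝ, EQ), Q; ℝ⟯) : C^∞⟮𝓘(ℝ, EQ), Q; ℝ⟯ :=
  ⟨fun q => dirDeriv f q (A.anchor.toFun q (σ q)), A.contMDiff_deriv σ f⟩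

/-- The function `α(σ)` for a section `α` of `E*` and a section `σ` of `E`. -/
def _root_.AffineHJ.pairing (α : Cₛ^∞⟮𝓘(ℝ, EQ); F →L[ℝ] ℝ, fun q => E q →L[ℝ] ℝ⟯)
    (σ : Cₛ^∞⟮𝓘(ℝ, EQ); F, E⟯) : C^∞⟮𝓘(ℝ, EQ), Q; ℝ⟯ :=
  ⟨fun q => α q (σ q), by
    have h := ContMDiff.clm_bundle_apply (F₁ := F) (E₁ := E) (F₂ := ℝ) (E₂ := fun _ : Q => ℝ)
      (b := fun q => q) α.contMDiff σ.contMDiff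
    intro q
    have := h q
    rw [contMDiffAt_totalSpace] at this
    exact this.2⟩

/-- The almost differential of a section of `E*`, evaluated on two sections of `E`. -/
def dOne (α : Cₛ^∞⟮𝓘(ℝ, EQ); F →L[ℝ] ℝ, fun q => E q →L[ℝ] ℝ⟯)
    (σ γ : Cₛ^∞⟮𝓘(ℝ, EQ); F, E⟯) : Q → ℝ := fun q =>
  A.deriv σ (pairing α γ) q - A.deriv γ (pairing α σ) q - pairing α (A.bracket σ γ) q

/-- `α` is a `1`-cocycle: `d^E α = 0`. -/
def IsCocycle (α : Cₛ^∞⟮𝓘(ℝ, EQ); F →L[ℝ] ℝ, fun q => E q →L[ℝ] ℝ⟯) : Prop :=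
  ∀ σ γ q, A.dOne α σ γ q = 0

/-- The distribution `ρ(E) ⊆ TQ`. -/
def distribution (q : Q) : Submodule ℝ (TangentSpace 𝓘(ℝ, EQ) q) :=
  LinearMap.range (A.anchor.toFun q)

/-- The function on `E*` that is `σ̂ + f ∘ τ`: the sum of the linear function of the section `σ`
of `E` and of the pull-back of the function `f` on `Q`. -/
def _root_.AffineHJ.linBasic (σ : Cₛ^∞⟮𝓘(ℝ, EQ); F, E⟯) (f : C^∞⟮𝓘(ℝ, EQ), Q; ℝ⟯) :
    TotalSpace (F →L[ℝ] ℝ) (fun q => E q →L[ℝ] ℝ) → ℝ :=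
  fun a => a.2 (σ a.1) + f a.1

/-- The linear almost Poisson bracket `{Φ, Ψ}` on `E*`, at the point `a ∈ E*`.
It is the bracket that is a derivation in each argument (so that `{Φ, Ψ}(a)` depends only on the
differentials of `Φ` and `Ψ` at `a`) and that satisfies
`{σ̂, γ̂} = -[σ, γ]^`, `{f ∘ τ, σ̂} = ρ(σ)(f) ∘ τ` and `{f ∘ τ, g ∘ τ} = 0`.
Every covector at `a` is the differential of a function `σ̂ + f ∘ τ`, and so the value of the
bracket is the number given by these relations on functions of this form. -/
def poisson (Φ Ψ : TotalSpace (F →L[ℝ] ℝ) (fun q => E q →L[ℝ] ℝ) → ℝ)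
    (a : TotalSpace (F →L[ℝ] ℝ) (fun q => E q →L[ℝ] ℝ)) : ℝ :=
  Classical.epsilon fun r : ℝ =>
    ∀ (σ γ : Cₛ^∞⟮𝓘(ℝ, EQ); F, E⟯) (f g : C^∞⟮𝓘(ℝ, EQ), Q; ℝ⟯),
      mfderiv (𝓘(ℝ, EQ).prod 𝓘(ℝ, F →L[ℝ] ℝ)) 𝓘(ℝ, ℝ) Φ a
        = mfderiv (𝓘(ℝ, EQ).prod 𝓘(ℝ, F →L[ℝ] ℝ)) 𝓘(ℝ, ℝ) (linBasic σ f) a →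
      mfderiv (𝓘(ℝ, EQ).prod 𝓘(ℝ, F →L[ℝ] ℝ)) 𝓘(ℝ, ℝ) Ψ a
        = mfderiv (𝓘(ℝ, EQ).prod 𝓘(ℝ, F →L[ℝ] ℝ)) 𝓘(ℝ, ℝ) (linBasic γ g) a →
      r = -(a.2 (A.bracket σ γ a.1)) + A.deriv γ f a.1 - A.deriv σ g a.1

/-- The skew-symmetric algebroid on `D` induced by an algebroid on `E`, an inclusion `i : D → E`
and a projector `P : E → D`: the bracket is `P [i σ, i γ]` and the anchor is `ρ ∘ i`. -/
def project {F' : Type*} [NormedAddCommGroup F'] [NormedSpace ℝ F']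
    {D : Q → Type*} [TopologicalSpace (TotalSpace F' D)] [∀ q, TopologicalSpace (D q)]
    [∀ q, AddCommGroup (D q)] [∀ q, Module ℝ (D q)] [FiberBundle F' D] [VectorBundle ℝ F' D]
    (i : BundleMap EQ F' D F E) (P : BundleMap EQ F E F' D)
    (hP : ∀ q (u : D q), P.toFun q (i.toFun q u) = u) : SkewAlgebroid EQ F' D where
  anchor := ⟨fun q => A.anchor.toFun q ∘ₗ i.toFun q, A.anchor.smooth.comp i.smooth⟩
  bracket σ γ := P.mapSection (A.bracket (i.mapSection σ) (i.mapSection γ))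
  bracket_add σ γ δ := by
    have h : i.mapSection (γ + δ) = i.mapSection γ + i.mapSection δ := by
      ext q; simp [BundleMap.mapSection]
    ext q; rw [h, A.bracket_add]; simp [BundleMap.mapSection]
  bracket_smul c σ γ := by
    have h : i.mapSection (c • γ) = c • i.mapSection γ := by
      ext q; simp [BundleMap.mapSection]
    ext q; rw [h, A.bracket_smul]; simp [BundleMap.mapSection]
  bracket_skew σ γ := by
    ext q; rw [A.bracket_skew]; simp [BundleMap.mapSection]
  leibniz σ γ f q := by
    have h : i.mapSection (smulSection f γ) = smulSection f (i.mapSection γ) := by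
      ext q; simp [BundleMap.mapSection, smulSection]
    rw [h]
    change P.toFun q (A.bracket _ _ q) = _
    rw [A.leibniz]
    simp [BundleMap.mapSection, hP]

end SkewAlgebroid

end Algebroid

/-! ### Subbundles and orthogonal projectors -/

section Projector

lemma finiteDimensional_fiber {Q : Type*} [TopologicalSpace Q]
    (FU : Type*) [NormedAddCommGroup FU] [NormedSpace ℝ FU] [FiniteDimensional ℝ FU]
    {U : Q → Type*} [TopologicalSpace (TotalSpace FU U)] [∀ q, TopologicalSpace (U q)]
    [∀ q, AddCommGroup (U q)] [∀ q, Module ℝ (U q)] [FiberBundle FU U] [VectorBundle ℝ FU U]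
    (q : Q) : FiniteDimensional ℝ (U q) :=
  LinearEquiv.finiteDimensional
    ((trivializationAt FU U q).continuousLinearEquivAt ℝ q
      (FiberBundle.mem_baseSet_trivializationAt' q)).symm.toLinearEquiv

variable {EQ : Type*} [NormedAddCommGroup EQ] [NormedSpace ℝ EQ]
  {Q : Type*} [TopologicalSpace Q] [ChartedSpace EQ Q]
  {F : Type*} [NormedAddCommGroup F] [NormedSpace ℝ F]
  {E : Q → Type*} [TopologicalSpace (TotalSpace F E)] [∀ q, TopologicalSpace (E q)]
  [∀ q, AddCommGroup (E q)] [∀ q, Module ℝ (E q)] [FiberBundle F E] [VectorBundle ℝ F E]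
  [∀ q, IsTopologicalAddGroup (E q)] [∀ q, ContinuousConstSMul ℝ (E q)]
  {FU : Type*} [NormedAddCommGroup FU] [NormedSpace ℝ FU] [FiniteDimensional ℝ FU]
  {U : Q → Type*} [TopologicalSpace (TotalSpace FU U)] [∀ q, TopologicalSpace (U q)]
  [∀ q, AddCommGroup (U q)] [∀ q, Module ℝ (U q)] [FiberBundle FU U] [VectorBundle ℝ FU U]

/-- A bundle metric on `E`. -/
abbrev Metric (EQ : Type*) [NormedAddCommGroup EQ] [NormedSpace ℝ EQ]
    {Q : Type*} [TopologicalSpace Q] [ChartedSpace EQ Q]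
    (F : Type*) [NormedAddCommGroup F] [NormedSpace ℝ F]
    (E : Q → Type*) [TopologicalSpace (TotalSpace F E)] [∀ q, TopologicalSpace (E q)]
    [∀ q, AddCommGroup (E q)] [∀ q, Module ℝ (E q)] [FiberBundle F E] [VectorBundle ℝ F E]
    [∀ q, IsTopologicalAddGroup (E q)] [∀ q, ContinuousConstSMul ℝ (E q)] :=
  ContMDiffRiemannianMetric 𝓘(ℝ, EQ) ∞ F E

/-- A vector subbundle `U` of `E`, given as a vector bundle with its inclusion into `E`. -/
structure Subbundle (EQ : Type*) [NormedAddCommGroup EQ] [NormedSpace ℝ EQ]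
    {Q : Type*} [TopologicalSpace Q] [ChartedSpace EQ Q]
    (FU : Type*) [NormedAddCommGroup FU] [NormedSpace ℝ FU]
    (U : Q → Type*) [TopologicalSpace (TotalSpace FU U)] [∀ q, TopologicalSpace (U q)]
    [∀ q, AddCommGroup (U q)] [∀ q, Module ℝ (U q)] [FiberBundle FU U]
    (F : Type*) [NormedAddCommGroup F] [NormedSpace ℝ F]
    (E : Q → Type*) [TopologicalSpace (TotalSpace F E)] [∀ q, TopologicalSpace (E q)]
    [∀ q, AddCommGroup (E q)] [∀ q, Module ℝ (E q)] [FiberBundle F E] where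
  /-- the inclusion `U → E` -/
  incl : BundleMap EQ FU U F E
  injective : ∀ q, Function.Injective (incl.toFun q)

variable (G : Metric EQ F E) (S : Subbundle EQ FU U F E)

/-- The restriction of the metric to `U`. -/
def subForm (q : Q) : LinearMap.BilinForm ℝ (U q) :=
  LinearMap.mk₂ ℝ (fun u v => G.inner q (S.incl.toFun q u) (S.incl.toFun q v))
    (by simp) (by simp) (by simp) (by simp)

lemma subForm_nondegenerate (q : Q) : (subForm G S q).Nondegenerate := by
  have key : ∀ u, subForm G S q u u = 0 → u = 0 := by
    intro u hu
    by_contra h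
    have h1 : S.incl.toFun q u ≠ 0 := fun h0 => h (S.injective q (by rw [h0, map_zero]))
    have := G.pos q _ h1
    simp only [subForm, LinearMap.mk₂_apply] at hu
    linarith
  exact ⟨fun u hu => key u (hu u), fun u hu => key u (hu u)⟩

/-- The isomorphism `U*_q → U_q` induced by the metric. -/
def sharp (q : Q) : Module.Dual ℝ (U q) →ₗ[ℝ] U q :=
  haveI : FiniteDimensional ℝ (U q) := finiteDimensional_fiber FU q
  ((subForm G S q).toDual (subForm_nondegenerate G S q)).symm.toLinearMap

lemma sharp_spec (q : Q) (η : Module.Dual ℝ (U q)) (v : U q) :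
    G.inner q (S.incl.toFun q (sharp G S q η)) (S.incl.toFun q v) = η v := by
  have : FiniteDimensional ℝ (U q) := finiteDimensional_fiber FU q
  exact LinearMap.BilinForm.apply_toDual_symm_apply
    (hB := subForm_nondegenerate G S q) η v

/-- The orthogonal projector `E_q → U_q`. -/
def orthProj (q : Q) : E q →ₗ[ℝ] U q :=
  sharp G S q ∘ₗ LinearMap.mk₂ ℝ (fun (e : E q) (v : U q) => G.inner q e (S.incl.toFun q v))
    (by simp) (by simp) (by simp) (by simp)

lemma orthProj_spec (q : Q) (e : E q) (v : U q) :
    G.inner q (S.incl.toFun q (orthProj G S q e)) (S.incl.toFun q v)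
      = G.inner q e (S.incl.toFun q v) :=
  sharp_spec G S q _ v

lemma sub_inj (q : Q) (u u' : U q)
    (h : ∀ v, G.inner q (S.incl.toFun q u) (S.incl.toFun q v)
      = G.inner q (S.incl.toFun q u') (S.incl.toFun q v)) : u = u' := by
  rw [← sub_eq_zero]
  refine (subForm_nondegenerate G S q).1 _ fun v => ?_
  simp [subForm, h v]

lemma orthProj_incl (q : Q) (u : U q) : orthProj G S q (S.incl.toFun q u) = u :=
  sub_inj G S q _ _ fun v => orthProj_spec G S q _ v

lemma orthProj_smooth [ContMDiffVectorBundle ∞ FU U 𝓘(ℝ, EQ)] :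
    ContMDiff (𝓘(ℝ, EQ).prod 𝓘(ℝ, F)) (𝓘(ℝ, EQ).prod 𝓘(ℝ, FU)) ∞
      (fun p : TotalSpace F E => (⟨p.1, orthProj G S p.1 p.2⟩ : TotalSpace FU U)) := by
  intro p₀
  rw [contMDiffAt_totalSpace]
  refine ⟨contMDiffAt_proj E, ?_⟩
  set e := trivializationAt FU U p₀.1 with he
  have hp₀ : p₀.1 ∈ e.baseSet := FiberBundle.mem_baseSet_trivializationAt' p₀.1
  let b := Module.finBasis ℝ FU
  -- the local frame, included in `E`
  let s : FU → ∀ q, E q := fun w q => S.incl.toFun q (e.symm q w)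
  have hs : ∀ w, ContMDiffAt (𝓘(ℝ, EQ).prod 𝓘(ℝ, F)) (𝓘(ℝ, EQ).prod 𝓘(ℝ, F)) ∞
      (fun p : TotalSpace F E => (⟨p.1, s w p.1⟩ : TotalSpace F E)) p₀ := by
    intro w
    have h1 : ContMDiffAt (𝓘(ℝ, EQ).prod 𝓘(ℝ, F)) (𝓘(ℝ, EQ).prod 𝓘(ℝ, FU)) ∞
        (fun p : TotalSpace F E => (⟨p.1, e.symm p.1 w⟩ : TotalSpace FU U)) p₀ := by
      have h2 := (e.contMDiffOn_symm (IB := 𝓘(ℝ, EQ)) (n := ∞)).contMDiffAt (x := (p₀.1, w))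
        (e.open_target.mem_nhds (by simp [e.mem_target, hp₀]))
      have h3 : ContMDiffAt (𝓘(ℝ, EQ).prod 𝓘(ℝ, F)) (𝓘(ℝ, EQ).prod 𝓘(ℝ, FU)) ∞
          (fun p : TotalSpace F E => (p.1, w)) p₀ :=
        (contMDiffAt_proj E).prodMk contMDiffAt_const
      refine (h2.comp p₀ h3).congr_of_eventuallyEq ?_
      have : ∀ᶠ p : TotalSpace F E in nhds p₀, p.1 ∈ e.baseSet :=
        (contMDiffAt_proj (n := ∞) (IB := 𝓘(ℝ, EQ)) E (p := p₀)).continuousAt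
          (e.open_baseSet.mem_nhds hp₀)
      filter_upwards [this] with p hp
      exact e.mk_symm hp w
    exact S.incl.smooth.contMDiffAt.comp p₀ h1
  have hG : ContMDiffAt (𝓘(ℝ, EQ).prod 𝓘(ℝ, F)) (𝓘(ℝ, EQ).prod 𝓘(ℝ, F →L[ℝ] F →L[ℝ] ℝ)) ∞
      (fun p : TotalSpace F E => TotalSpace.mk' (F →L[ℝ] F →L[ℝ] ℝ)
        (E := fun q => E q →L[ℝ] E q →L[ℝ] ℝ) p.1 (G.inner p.1)) p₀ :=
    G.contMDiff.contMDiffAt.comp p₀ (contMDiffAt_proj E)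
  have hval : ∀ (v w : ∀ p : TotalSpace F E, E p.1),
      ContMDiffAt (𝓘(ℝ, EQ).prod 𝓘(ℝ, F)) (𝓘(ℝ, EQ).prod 𝓘(ℝ, F)) ∞
        (fun p : TotalSpace F E => (⟨p.1, v p⟩ : TotalSpace F E)) p₀ →
      ContMDiffAt (𝓘(ℝ, EQ).prod 𝓘(ℝ, F)) (𝓘(ℝ, EQ).prod 𝓘(ℝ, F)) ∞
        (fun p : TotalSpace F E => (⟨p.1, w p⟩ : TotalSpace F E)) p₀ →
      ContMDiffAt (𝓘(ℝ, EQ).prod 𝓘(ℝ, F)) 𝓘(ℝ, ℝ) ∞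
        (fun p : TotalSpace F E => G.inner p.1 (v p) (w p)) p₀ := by
    intro v w hv hw
    have := ContMDiffAt.clm_bundle_apply₂ (F₁ := F) (F₂ := F) (F₃ := ℝ)
      (E₃ := fun _ : Q => ℝ) hG hv hw
    rw [contMDiffAt_totalSpace] at this
    exact this.2
  let B : TotalSpace F E → (FU →L[ℝ] FU →L[ℝ] ℝ) := fun p => ∑ a, ∑ c,
    (G.inner p.1 (s (b a) p.1) (s (b c) p.1) : ℝ) •
      (LinearMap.toContinuousLinearMap (b.coord a)).smulRight
        (LinearMap.toContinuousLinearMap (b.coord c))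
  let N : TotalSpace F E → (FU →L[ℝ] ℝ) := fun p => ∑ c,
    (G.inner p.1 p.2 (s (b c) p.1) : ℝ) • LinearMap.toContinuousLinearMap (b.coord c)
  have hB : ContMDiffAt (𝓘(ℝ, EQ).prod 𝓘(ℝ, F)) 𝓘(ℝ, FU →L[ℝ] FU →L[ℝ] ℝ) ∞ B p₀ :=
    ContMDiffAt.sum fun a _ => ContMDiffAt.sum fun c _ =>
      (hval _ _ (hs (b a)) (hs (b c))).smul contMDiffAt_const
  have hN : ContMDiffAt (𝓘(ℝ, EQ).prod 𝓘(ℝ, F)) 𝓘(ℝ, FU →L[ℝ] ℝ) ∞ N p₀ :=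
    ContMDiffAt.sum fun c _ => (hval _ _ contMDiffAt_id (hs (b c))).smul contMDiffAt_const
  have hsl : ∀ q ∈ e.baseSet, ∀ w : FU, s w q = ∑ a, b.coord a w • s (b a) q := by
    intro q hq w
    conv_lhs => rw [← b.sum_repr w]
    simp only [s, ← e.symmL_apply (R := ℝ) hq, map_sum, map_smul, Module.Basis.coord_apply]
  have hBv : ∀ p : TotalSpace F E, p.1 ∈ e.baseSet → ∀ w w' : FU,
      B p w w' = G.inner p.1 (s w p.1) (s w' p.1) := by
    intro p hp w w'
    rw [hsl _ hp w, hsl _ hp w']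
    simp [B, Finset.mul_sum, mul_comm, mul_left_comm]
    exact Finset.sum_comm
  have hNv : ∀ p : TotalSpace F E, p.1 ∈ e.baseSet → ∀ w' : FU,
      N p w' = G.inner p.1 p.2 (s w' p.1) := by
    intro p hp w'
    rw [hsl _ hp w']
    simp [N, mul_comm]
  have hinv : ∀ p : TotalSpace F E, p.1 ∈ e.baseSet → (B p).IsInvertible := by
    intro p hp
    have hinj : Function.Injective (B p) := by
      rw [injective_iff_map_eq_zero]
      intro w hw
      by_contra hne
      have h1 : s w p.1 ≠ 0 := by
        intro h0
        apply hne
        have h2 : e.symm p.1 w = 0 := S.injective _ (by rw [map_zero]; exact h0)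
        have h3 := e.apply_mk_symm hp w
        rw [h2] at h3
        have h4 := e.zeroSection ℝ hp
        have h5 : e (⟨p.1, 0⟩ : TotalSpace FU U) = (p.1, 0) := h4
        rw [h5] at h3
        exact (Prod.ext_iff.1 h3).2.symm
      have := G.pos p.1 _ h1
      rw [← hBv p hp, hw] at this
      simp at this
    have hfin : Module.finrank ℝ FU = Module.finrank ℝ (FU →L[ℝ] ℝ) := by
      rw [← (LinearMap.toContinuousLinearMap (𝕜 := ℝ) (E := FU) (F' := ℝ)).finrank_eq]
      exact (Subspace.dual_finrank_eq (K := ℝ) (V := FU)).symm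
    exact ⟨(LinearEquiv.ofInjectiveOfFinrankEq (B p).toLinearMap hinj hfin).toContinuousLinearEquiv,
      by ext; rfl⟩
  have hsm : ContMDiffAt (𝓘(ℝ, EQ).prod 𝓘(ℝ, F)) 𝓘(ℝ, FU) ∞
      (fun p => (B p).inverse (N p)) p₀ := by
    have h1 : ContMDiffAt 𝓘(ℝ, FU →L[ℝ] FU →L[ℝ] ℝ) 𝓘(ℝ, (FU →L[ℝ] ℝ) →L[ℝ] FU) ∞
        ContinuousLinearMap.inverse (B p₀) :=
      ((hinv p₀ hp₀).contDiffAt_map_inverse).contMDiffAt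
    exact (h1.comp p₀ hB).clm_apply hN
  refine hsm.congr_of_eventuallyEq ?_
  have : ∀ᶠ p : TotalSpace F E in nhds p₀, p.1 ∈ e.baseSet :=
    (contMDiffAt_proj (n := ∞) (IB := 𝓘(ℝ, EQ)) E (p := p₀)).continuousAt
      (e.open_baseSet.mem_nhds hp₀)
  filter_upwards [this] with p hp
  have hsym : s (e ⟨p.1, orthProj G S p.1 p.2⟩).2 p.1
      = S.incl.toFun p.1 (orthProj G S p.1 p.2) := by
    simp only [s]
    congr 1
    exact e.symm_apply_apply_mk hp _
  have hBN : B p (e ⟨p.1, orthProj G S p.1 p.2⟩).2 = N p := by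
    ext w
    rw [hBv p hp, hNv p hp, hsym]
    exact orthProj_spec G S p.1 p.2 _
  rw [← hBN]
  obtain ⟨L, hL⟩ := hinv p hp
  rw [← hL, ContinuousLinearMap.inverse_equiv]
  simp [he]

/-- The orthogonal projector `𝒫 : E → U` as a bundle morphism. -/
def projector [ContMDiffVectorBundle ∞ FU U 𝓘(ℝ, EQ)] : BundleMap EQ F E FU U :=
  ⟨orthProj G S, orthProj_smooth G S⟩

end Projector

/-! ### The algebroid `ℝ × E` -/

section ProdReal

variable {EQ : Type*} [NormedAddCommGroup EQ] [NormedSpace ℝ EQ]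
  {Q : Type*} [TopologicalSpace Q] [ChartedSpace EQ Q]
  {F : Type*} [NormedAddCommGroup F] [NormedSpace ℝ F]
  {E : Q → Type*} [TopologicalSpace (TotalSpace F E)] [∀ q, TopologicalSpace (E q)]
  [∀ q, AddCommGroup (E q)] [∀ q, Module ℝ (E q)] [FiberBundle F E] [VectorBundle ℝ F E]

/-- A map into the total space of `ℝ × E` is smooth iff its two components are. -/
lemma contMDiff_prodReal_iff {EM : Type*} [NormedAddCommGroup EM] [NormedSpace ℝ EM]
    {HM : Type*} [TopologicalSpace HM] {IM : ModelWithCorners ℝ EM HM}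
    {M : Type*} [TopologicalSpace M] [ChartedSpace HM M]
    (b : M → Q) (v : M → ℝ) (w : ∀ m, E (b m)) :
    ContMDiff IM (𝓘(ℝ, EQ).prod 𝓘(ℝ, ℝ × F)) ∞
        (fun m => (⟨b m, (v m, w m)⟩ : TotalSpace (ℝ × F) (fun q : Q => ℝ × E q))) ↔
      ContMDiff IM 𝓘(ℝ, ℝ) ∞ v ∧
        ContMDiff IM (𝓘(ℝ, EQ).prod 𝓘(ℝ, F)) ∞ (fun m => (⟨b m, w m⟩ : TotalSpace F E)) := by
  simp only [ContMDiff, contMDiffAt_totalSpace]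
  have key : ∀ m₀ : M, ContMDiffAt IM 𝓘(ℝ, ℝ × F) ∞ (fun m => (trivializationAt (ℝ × F)
        (fun q : Q => ℝ × E q) (b m₀) ⟨b m, (v m, w m)⟩).2) m₀ ↔
      ContMDiffAt IM 𝓘(ℝ, ℝ) ∞ v m₀ ∧
        ContMDiffAt IM 𝓘(ℝ, F) ∞ (fun m => (trivializationAt F E (b m₀) ⟨b m, w m⟩).2) m₀ := by
    intro m₀
    exact contMDiffAt_prod_module_iff _
  constructor
  · intro h
    exact ⟨fun m => ((key m).1 (h m).2).1, fun m => ⟨(h m).1, ((key m).1 (h m).2).2⟩⟩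
  · intro h m
    exact ⟨(h.2 m).1, (key m).2 ⟨h.1 m, (h.2 m).2⟩⟩

lemma contMDiff_smul_add {EM : Type*} [NormedAddCommGroup EM] [NormedSpace ℝ EM]
    {HM : Type*} [TopologicalSpace HM] {IM : ModelWithCorners ℝ EM HM}
    {M : Type*} [TopologicalSpace M] [ChartedSpace HM M]
    (b : M → Q) {v : M → ℝ} {x w : ∀ m, E (b m)} (hv : ContMDiff IM 𝓘(ℝ, ℝ) ∞ v)
    (hx : ContMDiff IM (𝓘(ℝ, EQ).prod 𝓘(ℝ, F)) ∞ (fun m => (⟨b m, x m⟩ : TotalSpace F E)))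
    (hw : ContMDiff IM (𝓘(ℝ, EQ).prod 𝓘(ℝ, F)) ∞ (fun m => (⟨b m, w m⟩ : TotalSpace F E))) :
    ContMDiff IM (𝓘(ℝ, EQ).prod 𝓘(ℝ, F)) ∞
      (fun m => (⟨b m, v m • x m + w m⟩ : TotalSpace F E)) := by
  intro m₀
  have hx' := contMDiffAt_totalSpace.1 (hx m₀)
  have hw' := contMDiffAt_totalSpace.1 (hw m₀)
  refine contMDiffAt_totalSpace.2 ⟨hx'.1, ?_⟩
  refine (((hv m₀).smul hx'.2).add hw'.2).congr_of_eventuallyEq ?_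
  have : ∀ᶠ m in nhds m₀, b m ∈ (trivializationAt F E (b m₀)).baseSet :=
    hx'.1.continuousAt ((trivializationAt F E (b m₀)).open_baseSet.mem_nhds
      (FiberBundle.mem_baseSet_trivializationAt' _))
  filter_upwards [this] with m hm
  have hl := (trivializationAt F E (b m₀)).linear ℝ hm
  simp [hl.map_add, hl.map_smul]

/-- The section `(f, σ)` of `ℝ × E`. -/
def pairSection (f : C^∞⟮𝓘(ℝ, EQ), Q; ℝ⟯) (σ : Cₛ^∞⟮𝓘(ℝ, EQ); F, E⟯) :
    Cₛ^∞⟮𝓘(ℝ, EQ); ℝ × F, fun q => ℝ × E q⟯ :=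
  ⟨fun q => (f q, σ q),
    (contMDiff_prodReal_iff (fun q => q) f σ).2 ⟨f.contMDiff, σ.contMDiff⟩⟩

/-- The first component of a section of `ℝ × E`. -/
def fstSection (s : Cₛ^∞⟮𝓘(ℝ, EQ); ℝ × F, fun q => ℝ × E q⟯) : C^∞⟮𝓘(ℝ, EQ), Q; ℝ⟯ :=
  ⟨fun q => (s q).1,
    ((contMDiff_prodReal_iff (E := E) (fun q => q) (fun q => (s q).1) (fun q => (s q).2)).1
      s.contMDiff).1⟩

/-- The second component of a section of `ℝ × E`. -/
def sndSection (s : Cₛ^∞⟮𝓘(ℝ, EQ); ℝ × F, fun q => ℝ × E q⟯) : Cₛ^∞⟮𝓘(ℝ, EQ); F, E⟯ :=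
  ⟨fun q => (s q).2,
    ((contMDiff_prodReal_iff (E := E) (fun q => q) (fun q => (s q).1) (fun q => (s q).2)).1
      s.contMDiff).2⟩

variable [IsManifold 𝓘(ℝ, EQ) ∞ Q]

/-- The algebroid `ℝ × E` with
`[(f, σ), (g, γ)] = (ρ(σ)(g) - ρ(γ)(f), [σ, γ])` and `ρ(f, σ) = ρ(σ)`. -/
def SkewAlgebroid.prodReal (A : SkewAlgebroid EQ F E) :
    SkewAlgebroid EQ (ℝ × F) (fun q => ℝ × E q) where
  anchor := ⟨fun q => A.anchor.toFun q ∘ₗ LinearMap.snd ℝ ℝ (E q),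
    A.anchor.smooth.comp ((contMDiff_prodReal_iff (E := E)
      (fun p : TotalSpace (ℝ × F) (fun q => ℝ × E q) => p.1) (fun p => p.2.1)
      (fun p => p.2.2)).1 contMDiff_id).2⟩
  bracket s t := pairSection
    (A.deriv (sndSection s) (fstSection t) - A.deriv (sndSection t) (fstSection s))
    (A.bracket (sndSection s) (sndSection t))
  bracket_add s t t' := by
    have h1 : sndSection (t + t') = sndSection t + sndSection t' := by ext q; rfl
    have h2 : fstSection (t + t') = fstSection t + fstSection t' := by ext q; rfl
    rw [h1, h2, A.bracket_add]
    refine ContMDiffSection.ext fun q => Prod.ext ?_ rfl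
    change dirDeriv (fstSection t + fstSection t' : C^∞⟮𝓘(ℝ, EQ), Q; ℝ⟯) q
        (A.anchor.toFun q (sndSection s q))
      - dirDeriv (fstSection s) q (A.anchor.toFun q (sndSection t q + sndSection t' q))
      = (dirDeriv (fstSection t) q (A.anchor.toFun q (sndSection s q))
        - dirDeriv (fstSection s) q (A.anchor.toFun q (sndSection t q)))
      + (dirDeriv (fstSection t') q (A.anchor.toFun q (sndSection s q))
        - dirDeriv (fstSection s) q (A.anchor.toFun q (sndSection t' q)))
    rw [dirDeriv_add, map_add, dirDeriv_map_add]
    ring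
  bracket_smul c s t := by
    have h1 : sndSection (c • t) = c • sndSection t := by ext q; rfl
    have h2 : fstSection (c • t) = c • fstSection t := by ext q; rfl
    rw [h1, h2, A.bracket_smul]
    refine ContMDiffSection.ext fun q => Prod.ext ?_ rfl
    change dirDeriv (c • fstSection t : C^∞⟮𝓘(ℝ, EQ), Q; ℝ⟯) q
        (A.anchor.toFun q (sndSection s q))
      - dirDeriv (fstSection s) q (A.anchor.toFun q (c • sndSection t q))
      = c * (dirDeriv (fstSection t) q (A.anchor.toFun q (sndSection s q))
        - dirDeriv (fstSection s) q (A.anchor.toFun q (sndSection t q)))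
    rw [dirDeriv_smul, map_smul, dirDeriv_map_smul]
    ring
  bracket_skew s t := by
    rw [A.bracket_skew]
    refine ContMDiffSection.ext fun q => Prod.ext ?_ rfl
    exact (neg_sub _ _).symm
  leibniz s t f q := by
    have h1 : sndSection (smulSection f t) = smulSection f (sndSection t) := by ext q; rfl
    have h2 : fstSection (smulSection f t) = f * fstSection t := by ext q; rfl
    rw [h1, h2]
    refine Prod.ext ?_ (A.leibniz _ _ _ _)
    change dirDeriv (f * fstSection t : C^∞⟮𝓘(ℝ, EQ), Q; ℝ⟯) q
        (A.anchor.toFun q (sndSection s q))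
      - dirDeriv (fstSection s) q (A.anchor.toFun q (f q • sndSection t q))
      = f q * (dirDeriv (fstSection t) q (A.anchor.toFun q (sndSection s q))
        - dirDeriv (fstSection s) q (A.anchor.toFun q (sndSection t q)))
      + dirDeriv f q (A.anchor.toFun q (sndSection s q)) * fstSection t q
    rw [dirDeriv_mul, map_smul, dirDeriv_map_smul]
    ring

end ProdReal

/-! ### Mechanical systems subjected to affine nonholonomic constraints -/

section Affine

/-- A mechanical system subjected to affine nonholonomic constraints on `E`: a subbundle `U` of `E`,
a bundle metric on `E`, a potential, and a section `X₀` of `E` with `𝒫(X₀) = 0`. -/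
structure AffineSystem (EQ : Type*) [NormedAddCommGroup EQ] [NormedSpace ℝ EQ]
    {Q : Type*} [TopologicalSpace Q] [ChartedSpace EQ Q]
    (F : Type*) [NormedAddCommGroup F] [NormedSpace ℝ F]
    (E : Q → Type*) [TopologicalSpace (TotalSpace F E)] [∀ q, TopologicalSpace (E q)]
    [∀ q, AddCommGroup (E q)] [∀ q, Module ℝ (E q)] [FiberBundle F E] [VectorBundle ℝ F E]
    [∀ q, IsTopologicalAddGroup (E q)] [∀ q, ContinuousConstSMul ℝ (E q)]
    (FU : Type*) [NormedAddCommGroup FU] [NormedSpace ℝ FU] [FiniteDimensional ℝ FU]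
    (U : Q → Type*) [TopologicalSpace (TotalSpace FU U)] [∀ q, TopologicalSpace (U q)]
    [∀ q, AddCommGroup (U q)] [∀ q, Module ℝ (U q)] [FiberBundle FU U] [VectorBundle ℝ FU U] where
  sub : Subbundle EQ FU U F E
  metric : Metric EQ F E
  potential : C^∞⟮𝓘(ℝ, EQ), Q; ℝ⟯
  X₀ : Cₛ^∞⟮𝓘(ℝ, EQ); F, E⟯
  proj_X₀ : ∀ q, orthProj metric sub q (X₀ q) = 0

namespace AffineSystem

variable {EQ : Type*} [NormedAddCommGroup EQ] [NormedSpace ℝ EQ]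
  {Q : Type*} [TopologicalSpace Q] [ChartedSpace EQ Q] [IsManifold 𝓘(ℝ, EQ) ∞ Q]
  {F : Type*} [NormedAddCommGroup F] [NormedSpace ℝ F]
  {E : Q → Type*} [TopologicalSpace (TotalSpace F E)] [∀ q, TopologicalSpace (E q)]
  [∀ q, AddCommGroup (E q)] [∀ q, Module ℝ (E q)] [FiberBundle F E] [VectorBundle ℝ F E]
  [∀ q, IsTopologicalAddGroup (E q)] [∀ q, ContinuousConstSMul ℝ (E q)]
  {FU : Type*} [NormedAddCommGroup FU] [NormedSpace ℝ FU] [FiniteDimensional ℝ FU]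
  {U : Q → Type*} [TopologicalSpace (TotalSpace FU U)] [∀ q, TopologicalSpace (U q)]
  [∀ q, AddCommGroup (U q)] [∀ q, Module ℝ (U q)] [FiberBundle FU U] [VectorBundle ℝ FU U]
  [ContMDiffVectorBundle ∞ FU U 𝓘(ℝ, EQ)]
  (M : AffineSystem EQ F E FU U) (A : SkewAlgebroid EQ F E)

/-- The inclusion of `Ũ` into `ℝ × E`. The bundle `Ũ`, whose fibre at `q` is
`{(λ, λ X₀(q) + u) | λ ∈ ℝ, u ∈ U_q} ⊆ ℝ × E_q`, is given as the bundle `ℝ × U` with the inclusion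
`(λ, u) ↦ (λ, λ X₀(q) + u)`. -/
def inclTilde : BundleMap EQ (ℝ × FU) (fun q => ℝ × U q) (ℝ × F) (fun q => ℝ × E q) where
  toFun q := (LinearMap.fst ℝ ℝ (U q)).prod
    ((LinearMap.fst ℝ ℝ (U q)).smulRight (M.X₀ q) + M.sub.incl.toFun q ∘ₗ LinearMap.snd ℝ ℝ (U q))
  smooth := by
    have h := (contMDiff_prodReal_iff (EQ := EQ) (E := U)
      (fun p : TotalSpace (ℝ × FU) (fun q => ℝ × U q) => p.1) (fun p => p.2.1)
      (fun p => p.2.2)).1 contMDiff_id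
    refine (contMDiff_prodReal_iff (E := E) _ _ _).2 ⟨h.1, ?_⟩
    exact contMDiff_smul_add (fun p : TotalSpace (ℝ × FU) (fun q => ℝ × U q) => p.1) h.1
      (M.X₀.contMDiff.comp (contMDiff_proj _)) (M.sub.incl.smooth.comp h.2)

/-- The morphism `𝒫̃ : ℝ × E → Ũ`, `(λ, e) ↦ (λ, λ X₀ + 𝒫 e)`; in terms of the pairs `(λ, u)`
which stand for `(λ, λ X₀ + u)` it is `(λ, e) ↦ (λ, 𝒫 e)`. -/
def projTilde : BundleMap EQ (ℝ × F) (fun q => ℝ × E q) (ℝ × FU) (fun q => ℝ × U q) where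
  toFun q := LinearMap.id.prodMap (orthProj M.metric M.sub q)
  smooth := by
    have h := (contMDiff_prodReal_iff (EQ := EQ) (E := E)
      (fun p : TotalSpace (ℝ × F) (fun q => ℝ × E q) => p.1) (fun p => p.2.1)
      (fun p => p.2.2)).1 contMDiff_id
    exact (contMDiff_prodReal_iff (E := U) _ _ _).2
      ⟨h.1, (orthProj_smooth M.metric M.sub).comp h.2⟩

/-- The skew-symmetric algebroid structure on `U`. -/
def algebroidU : SkewAlgebroid EQ FU U :=
  A.project M.sub.incl (projector M.metric M.sub) (orthProj_incl M.metric M.sub)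

/-- The skew-symmetric algebroid structure on `Ũ`. -/
def algebroidTilde : SkewAlgebroid EQ (ℝ × FU) (fun q => ℝ × U q) :=
  A.prodReal.project M.inclTilde M.projTilde (by
    rintro q ⟨c, u⟩
    have h := M.proj_X₀ q
    simp [inclTilde, projTilde, h, orthProj_incl])

/-- The total space of `U*`, the phase space of the system. -/
abbrev DualU (FU : Type*) [NormedAddCommGroup FU] [NormedSpace ℝ FU]
    {Q : Type*} [TopologicalSpace Q]
    (U : Q → Type*) [TopologicalSpace (TotalSpace FU U)] [∀ q, TopologicalSpace (U q)]
    [∀ q, AddCommGroup (U q)] [∀ q, Module ℝ (U q)] : Type _ :=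
  TotalSpace (FU →L[ℝ] ℝ) (fun q => U q →L[ℝ] ℝ)

/-- The total space of `𝒰⁺ = Ũ*`. -/
abbrev DualTilde (FU : Type*) [NormedAddCommGroup FU] [NormedSpace ℝ FU]
    {Q : Type*} [TopologicalSpace Q]
    (U : Q → Type*) [TopologicalSpace (TotalSpace FU U)] [∀ q, TopologicalSpace (U q)]
    [∀ q, AddCommGroup (U q)] [∀ q, Module ℝ (U q)] : Type _ :=
  TotalSpace (ℝ × FU →L[ℝ] ℝ) (fun q => ℝ × U q →L[ℝ] ℝ)

/-- The projection `μ : 𝒰⁺ → U*` on the fibres over `q`: the restriction of a linear form on `Ũ_q`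
to `U_q = {(0, u)} ⊆ Ũ_q`. -/
def muFib (q : Q) (a : ℝ × U q →L[ℝ] ℝ) : U q →L[ℝ] ℝ :=
  a.comp (ContinuousLinearMap.inr ℝ ℝ (U q))

/-- The projection `μ : 𝒰⁺ → U*`. -/
def mu (a : DualTilde FU U) : DualU FU U := ⟨a.1, muFib a.1 a.2⟩

/-- The bundle metric `𝒢_{U*}` on `U*` induced by `𝒢`. -/
def dualMetric (q : Q) (η ζ : U q →L[ℝ] ℝ) : ℝ :=
  M.metric.inner q (M.sub.incl.toFun q (sharp M.metric M.sub q η.toLinearMap))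
    (M.sub.incl.toFun q (sharp M.metric M.sub q ζ.toLinearMap))

/-- The Hamiltonian function `H(η) = ½ 𝒢_{U*}(η, η) + 𝕍(q)` on `U*`. -/
def hamiltonian (η : DualU FU U) : ℝ :=
  1 / 2 * M.dualMetric η.1 η.2 η.2 + M.potential η.1

/-- The distinguished section `φ` of `𝒰⁺`, `φ(λ, λ X₀ + u) = λ`. -/
def phi (q : Q) : ℝ × U q →L[ℝ] ℝ := ContinuousLinearMap.fst ℝ ℝ (U q)

/-- The element `(1, X₀(q))` of `Ũ_q`. -/
def oneX₀ (q : Q) : ℝ × U q := (1, 0)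

lemma inclTilde_oneX₀ (q : Q) : M.inclTilde.toFun q (oneX₀ q) = (1, M.X₀ q) := by
  simp [inclTilde, oneX₀]

/-- The Hamiltonian section `h : U* → 𝒰⁺`, `h(η)(λ, λ X₀ + u) = η(u) - λ H(η)`, on the fibres
over `q`. -/
def hamSectionFib (q : Q) (η : U q →L[ℝ] ℝ) : ℝ × U q →L[ℝ] ℝ :=
  η.comp (ContinuousLinearMap.snd ℝ ℝ (U q)) - M.hamiltonian ⟨q, η⟩ • phi q

/-- The function `F_h` on `𝒰⁺`, characterized by `a - h(μ(a)) = F_h(a) φ`. -/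
def hamFunction (a : DualTilde FU U) : ℝ :=
  (a.2 - M.hamSectionFib a.1 (muFib a.1 a.2) : ℝ × U a.1 →L[ℝ] ℝ) (oneX₀ a.1)

lemma hamFunction_spec (q : Q) (a : ℝ × U q →L[ℝ] ℝ) :
    a - M.hamSectionFib q (muFib q a) = M.hamFunction ⟨q, a⟩ • phi q := by
  ext <;> simp [hamFunction, hamSectionFib, muFib, phi, oneX₀]

/-- The Hamiltonian vector field `R_h` on `U*`, characterized by
`R_h(Φ) ∘ μ = {Φ ∘ μ, F_h}` for all smooth functions `Φ` on `U*`. -/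
def hamVectorField (η : DualU FU U) :
    TangentSpace (𝓘(ℝ, EQ).prod 𝓘(ℝ, FU →L[ℝ] ℝ)) η :=
  haveI : Nonempty (TangentSpace (𝓘(ℝ, EQ).prod 𝓘(ℝ, FU →L[ℝ] ℝ)) η) := ⟨0⟩
  Classical.epsilon fun v : TangentSpace (𝓘(ℝ, EQ).prod 𝓘(ℝ, FU →L[ℝ] ℝ)) η =>
    ∀ (Φ : C^∞⟮𝓘(ℝ, EQ).prod 𝓘(ℝ, FU →L[ℝ] ℝ), DualU FU U; ℝ⟯) (a : DualTilde FU U),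
      mu a = η →
        mfderiv (𝓘(ℝ, EQ).prod 𝓘(ℝ, FU →L[ℝ] ℝ)) 𝓘(ℝ, ℝ) Φ η v
          = (M.algebroidTilde A).poisson (Φ ∘ mu) M.hamFunction a

/-- The vector field `R_h^α = Tτ ∘ R_h ∘ α` on `Q`, for a section `α` of `τ : U* → Q`. -/
def baseVectorField (α : ∀ q, U q →L[ℝ] ℝ) (q : Q) : TangentSpace 𝓘(ℝ, EQ) q :=
  mfderiv (𝓘(ℝ, EQ).prod 𝓘(ℝ, FU →L[ℝ] ℝ)) 𝓘(ℝ, EQ)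
    (TotalSpace.proj : DualU FU U → Q) ⟨q, α q⟩ (M.hamVectorField A ⟨q, α q⟩)

end AffineSystem

end Affine

end AffineHJ
end

/-! Along a closed section the Poisson bracket turns into derivatives on `Q`. Let `α` be a cocycle
and let `Φ`, `Ψ` have at `α(q)` the same differentials as `σ̂ + f ∘ τ` and `γ̂ + g ∘ τ`. Then `σ(q)
= x` and `γ(q) = y` are the fibre derivatives of `Φ` and `Ψ`, and `Φ ∘ α` has at `q` the
differential of `α(σ) + f`. Closedness rewrites `-α([σ, γ])` as `ρ(γ)(α(σ)) - ρ(σ)(α(γ))`, hence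
`{Φ, Ψ} ∘ α = ρ(y)(Φ ∘ α) - ρ(x)(Ψ ∘ α)` (`SkewAlgebroid.poisson_cocycle`).

Take `Ψ = F_h`. Since `F_h(a) = a(1, X₀) + H(μ(a))`, its fibre derivative at `β` is `(1, X₀ + (μ ∘
β)^♯)`, and `F_h ∘ β` is the energy `H ∘ μ ∘ β + β(1, X₀)`. For `Φ ∘ μ` the fibre derivative is `(0,
u)`, with `u` that of `Φ`. Therefore `R_h` at `μ(β(q))` is the vector tangent to the section `μ ∘ β`
over `ρ(X₀ + (μ ∘ β)^♯)`, minus the vertical lift of the covector `u ↦ ρ(u)(energy)`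
(`hamVectorField_cocycle`). The projection to `Q` kills the vertical term, so lifted integral curves
solve the Hamilton equations exactly when that covector vanishes at every point, because an integral
curve passes through every point (`integralCurves_iff`).

It remains to see that a function annihilated by `ρ(U)` is constant. The vector fields annihilating
a function are closed under Lie brackets, so complete nonholonomicity makes the whole differential
vanish, and `Q` is connected (`CompletelyNonholonomic.exists_eq_const`).

The bracket and `R_h` are values of `Classical.epsilon`. Each time a solution of the defining
relations is exhibited, and it is the only one because every covector on a dual bundle is the
differential of some `σ̂ + f ∘ τ` (`exists_mfderiv_linBasic_eq`). -/

noncomputable section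

set_option linter.unusedSectionVars false

namespace AffineHJ

/-! ### Tangent vectors of the total space of a vector bundle -/

section TotalSpaceTangent

variable {EQ : Type*} [NormedAddCommGroup EQ] [NormedSpace ℝ EQ]
  {Q : Type*} [TopologicalSpace Q] [ChartedSpace EQ Q]
  {F : Type*} [NormedAddCommGroup F] [NormedSpace ℝ F]
  {E : Q → Type*} [TopologicalSpace (TotalSpace F E)] [∀ q, TopologicalSpace (E q)]
  [∀ q, AddCommGroup (E q)] [∀ q, Module ℝ (E q)] [FiberBundle F E] [VectorBundle ℝ F E]

/-- The vertical lift `E_q → T_a E` at a point `a ∈ E_q`. -/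
def vertLift (a : TotalSpace F E) :
    E a.1 →ₗ[ℝ] TangentSpace (𝓘(ℝ, EQ).prod 𝓘(ℝ, F)) a :=
  -- The tangent space at `a` is the model `EQ × F`, read in the preferred chart at `a`, whose fibre
  -- coordinate is the trivialization at `a.1`; hence vertical vectors are those with first
  -- component `0`.
  (LinearMap.inr ℝ EQ F) ∘ₗ ((trivializationAt F E a.1).linearMapAt ℝ a.1)

lemma vertLift_apply (a : TotalSpace F E) (ζ : E a.1) :
    (vertLift a ζ : TangentSpace (𝓘(ℝ, EQ).prod 𝓘(ℝ, F)) a)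
      = ((0 : EQ), (trivializationAt F E a.1 ⟨a.1, ζ⟩).2) := by
  have := (trivializationAt F E a.1).linearMapAt_apply (R := ℝ) (b := a.1) ζ
  rw [if_pos (FiberBundle.mem_baseSet_trivializationAt' a.1)] at this
  exact congrArg (Prod.mk (0 : EQ)) this

/-- The preferred chart at `a` is built over the preferred chart at `a.1`, so on its whole target
the projection reads as the first coordinate. -/
lemma hasMFDerivAt_proj (a : TotalSpace F E) :
    HasMFDerivAt (𝓘(ℝ, EQ).prod 𝓘(ℝ, F)) 𝓘(ℝ, EQ) (TotalSpace.proj : TotalSpace F E → Q) a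
      (ContinuousLinearMap.fst ℝ EQ F) := by
  refine ⟨(FiberBundle.continuous_proj F E).continuousAt, ?_⟩
  have h0 : (extChartAt (𝓘(ℝ, EQ).prod 𝓘(ℝ, F)) a).target ∈
      nhds (extChartAt (𝓘(ℝ, EQ).prod 𝓘(ℝ, F)) a a) := extChartAt_target_mem_nhds a
  refine HasFDerivAt.hasFDerivWithinAt ?_
  refine (hasFDerivAt_fst (𝕜 := ℝ) (E := EQ) (F := F)).congr_of_eventuallyEq ?_
  filter_upwards [h0] with y hy
  have h1 := FiberBundle.chartedSpace_chartAt_symm_fst (HB := EQ) (E := E) (F := F) a y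
    (by rw [extChartAt, OpenPartialHomeomorph.extend_target] at hy; exact hy.1)
  rw [FiberBundle.extChartAt_target] at hy
  simp only [writtenInExtChartAt, Function.comp]
  have h2 : ((extChartAt (𝓘(ℝ, EQ).prod 𝓘(ℝ, F)) a).symm y).proj
      = (extChartAt 𝓘(ℝ, EQ) a.proj).symm y.1 := h1
  rw [h2]
  exact (extChartAt 𝓘(ℝ, EQ) a.proj).right_inv hy.1.1

lemma mfderiv_proj_apply (a : TotalSpace F E)
    (w : TangentSpace (𝓘(ℝ, EQ).prod 𝓘(ℝ, F)) a) :
    mfderiv (𝓘(ℝ, EQ).prod 𝓘(ℝ, F)) 𝓘(ℝ, EQ) (TotalSpace.proj : TotalSpace F E → Q) a w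
      = (show EQ × F from w).1 := by
  rw [(hasMFDerivAt_proj a).mfderiv]; rfl

lemma mfderiv_proj_sub_vertLift (a : TotalSpace F E)
    (w : TangentSpace (𝓘(ℝ, EQ).prod 𝓘(ℝ, F)) a) (ζ : E a.1) :
    mfderiv (𝓘(ℝ, EQ).prod 𝓘(ℝ, F)) 𝓘(ℝ, EQ) (TotalSpace.proj : TotalSpace F E → Q) a
      (w - vertLift a ζ)
      = mfderiv (𝓘(ℝ, EQ).prod 𝓘(ℝ, F)) 𝓘(ℝ, EQ) (TotalSpace.proj : TotalSpace F E → Q) a w := by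
  rw [mfderiv_proj_apply, mfderiv_proj_apply, vertLift_apply]
  exact sub_zero (show EQ × F from w).1

lemma mfderiv_proj_section {α : ∀ q, E q} {q : Q}
    (hα : MDifferentiableAt 𝓘(ℝ, EQ) (𝓘(ℝ, EQ).prod 𝓘(ℝ, F))
      (fun q => (⟨q, α q⟩ : TotalSpace F E)) q) (v : TangentSpace 𝓘(ℝ, EQ) q) :
    mfderiv (𝓘(ℝ, EQ).prod 𝓘(ℝ, F)) 𝓘(ℝ, EQ) (TotalSpace.proj : TotalSpace F E → Q) ⟨q, α q⟩
      (mfderiv 𝓘(ℝ, EQ) (𝓘(ℝ, EQ).prod 𝓘(ℝ, F)) (fun q => (⟨q, α q⟩ : TotalSpace F E)) q v)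
      = v := by
  have h := (hasMFDerivAt_proj (EQ := EQ) (⟨q, α q⟩ : TotalSpace F E)).comp q hα.hasMFDerivAt
  have h2 : HasMFDerivAt 𝓘(ℝ, EQ) 𝓘(ℝ, EQ)
    ((TotalSpace.proj : TotalSpace F E → Q) ∘ fun q => (⟨q, α q⟩ : TotalSpace F E)) q
    (ContinuousLinearMap.id ℝ (TangentSpace 𝓘(ℝ, EQ) q)) := hasMFDerivAt_id q
  have h3 := hasMFDerivAt_unique h h2
  rw [mfderiv_proj_apply]
  exact congrArg (fun L : EQ →L[ℝ] EQ => L v) h3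

/-- A tangent vector of the total space is the sum of a vector tangent to a given section and of
a vertical vector. -/
lemma exists_eq_mfderiv_section_add_vertLift {α : ∀ q, E q} {q : Q}
    (hα : MDifferentiableAt 𝓘(ℝ, EQ) (𝓘(ℝ, EQ).prod 𝓘(ℝ, F))
      (fun q => (⟨q, α q⟩ : TotalSpace F E)) q)
    (w : TangentSpace (𝓘(ℝ, EQ).prod 𝓘(ℝ, F)) (⟨q, α q⟩ : TotalSpace F E)) :
    ∃ (v : TangentSpace 𝓘(ℝ, EQ) q) (ζ : E q),
      w = mfderiv 𝓘(ℝ, EQ) (𝓘(ℝ, EQ).prod 𝓘(ℝ, F)) (fun q => (⟨q, α q⟩ : TotalSpace F E)) q v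
        + vertLift ⟨q, α q⟩ ζ := by
  set e := trivializationAt F E q
  set D := mfderiv 𝓘(ℝ, EQ) (𝓘(ℝ, EQ).prod 𝓘(ℝ, F)) (fun q => (⟨q, α q⟩ : TotalSpace F E)) q
  let w' : EQ × F := w
  let d : EQ × F := D w'.1
  -- The base component of `w` determines `v`. What is left of `w` after removing the image of `v`
  -- has base component `0`, and `ζ` is its fibre component carried back by the trivialization.
  refine ⟨w'.1, e.symm q (w'.2 - d.2), ?_⟩
  have h1 : d.1 = w'.1 := by
    have := mfderiv_proj_section hα w'.1
    rwa [mfderiv_proj_apply] at this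
  rw [vertLift_apply]
  have h2 : (e ⟨q, e.symm q (w'.2 - d.2)⟩).2 = w'.2 - d.2 := by
    rw [e.apply_mk_symm (FiberBundle.mem_baseSet_trivializationAt' q)]
  change w' = d + ((0 : EQ), (e ⟨q, e.symm q (w'.2 - d.2)⟩).2)
  rw [h2]
  ext <;> simp [h1]

lemma covector_ext {α : ∀ q, E q} {q : Q}
    (hα : MDifferentiableAt 𝓘(ℝ, EQ) (𝓘(ℝ, EQ).prod 𝓘(ℝ, F))
      (fun q => (⟨q, α q⟩ : TotalSpace F E)) q)
    {ξ ξ' : TangentSpace (𝓘(ℝ, EQ).prod 𝓘(ℝ, F)) (⟨q, α q⟩ : TotalSpace F E) →L[ℝ] ℝ}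
    (h : ∀ v : TangentSpace 𝓘(ℝ, EQ) q,
      ξ (mfderiv 𝓘(ℝ, EQ) (𝓘(ℝ, EQ).prod 𝓘(ℝ, F)) (fun q => (⟨q, α q⟩ : TotalSpace F E)) q v)
      = ξ' (mfderiv 𝓘(ℝ, EQ) (𝓘(ℝ, EQ).prod 𝓘(ℝ, F)) (fun q => (⟨q, α q⟩ : TotalSpace F E)) q v))
    (h' : ∀ ζ : E q, ξ (vertLift ⟨q, α q⟩ ζ) = ξ' (vertLift ⟨q, α q⟩ ζ)) : ξ = ξ' := by
  refine ContinuousLinearMap.ext fun w => ?_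
  obtain ⟨v, ζ, rfl⟩ := exists_eq_mfderiv_section_add_vertLift hα w
  rw [map_add, map_add, h, h']

/-- The trivialization is linear on fibres, so in the chart the line is an affine line with constant
base coordinate. -/
lemma hasMFDerivAt_fiberLine (q : Q) (a ζ : E q) :
    HasMFDerivAt 𝓘(ℝ, ℝ) (𝓘(ℝ, EQ).prod 𝓘(ℝ, F))
      (fun t : ℝ => (⟨q, a + t • ζ⟩ : TotalSpace F E)) 0
      ((1 : ℝ →L[ℝ] ℝ).smulRight (vertLift (EQ := EQ) (⟨q, a⟩ : TotalSpace F E) ζ : EQ × F)) := by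
  set e := trivializationAt F E q
  have hq : q ∈ e.baseSet := FiberBundle.mem_baseSet_trivializationAt' q
  have hl : ∀ t : ℝ, (e ⟨q, a + t • ζ⟩).2 = (e ⟨q, a⟩).2 + t • (e ⟨q, ζ⟩).2 := by
    intro t
    rw [(e.linear ℝ hq).map_add, (e.linear ℝ hq).map_smul]
  refine ⟨?_, ?_⟩
  · rw [FiberBundle.continuousAt_totalSpace]
    refine ⟨continuousAt_const, ?_⟩
    change ContinuousAt (fun t : ℝ => (e ⟨q, a + t • ζ⟩).2) 0
    simp only [hl]
    fun_prop
  · refine HasFDerivAt.hasFDerivWithinAt ?_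
    have h1 : HasDerivAt (fun t : ℝ => ((extChartAt 𝓘(ℝ, EQ) q q : EQ),
        (e ⟨q, a⟩).2 + t • (e ⟨q, ζ⟩).2)) ((0 : EQ), (e ⟨q, ζ⟩).2) 0 := by
      refine (hasDerivAt_const _ _).prodMk ?_
      simpa using ((hasDerivAt_id (0 : ℝ)).smul_const (e ⟨q, ζ⟩).2).const_add (e ⟨q, a⟩).2
    have h2 := h1.hasFDerivAt
    rw [vertLift_apply]
    refine HasFDerivAt.congr_of_eventuallyEq (f := fun t : ℝ => ((extChartAt 𝓘(ℝ, EQ) q q : EQ),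
        (e ⟨q, a⟩).2 + t • (e ⟨q, ζ⟩).2)) ?_ (Filter.Eventually.of_forall fun t => ?_)
    · have h3 : ContinuousLinearMap.toSpanSingleton ℝ ((0 : EQ), (e ⟨q, ζ⟩).2)
          = (1 : ℝ →L[ℝ] ℝ).smulRight ((0 : EQ), (e ⟨q, ζ⟩).2) := by ext <;> simp
      rw [h3] at h2
      exact h2
    · change _ = ((extChartAt 𝓘(ℝ, EQ) q q : EQ), (e ⟨q, a⟩).2 + t • (e ⟨q, ζ⟩).2)
      rw [← hl]
      simp only [writtenInExtChartAt, Function.comp, FiberBundle.extChartAt]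
      refine Prod.ext ?_ rfl
      change extChartAt 𝓘(ℝ, EQ) q (e ⟨q, a + _ • ζ⟩).1 = _
      rw [e.coe_fst' hq]

lemma hasDerivAt_fiberLine {Φ : TotalSpace F E → ℝ} {q : Q} {a : E q}
    (hΦ : MDifferentiableAt (𝓘(ℝ, EQ).prod 𝓘(ℝ, F)) 𝓘(ℝ, ℝ) Φ ⟨q, a⟩) (ζ : E q) :
    HasDerivAt (fun t : ℝ => Φ ⟨q, a + t • ζ⟩)
      (mfderiv (𝓘(ℝ, EQ).prod 𝓘(ℝ, F)) 𝓘(ℝ, ℝ) Φ ⟨q, a⟩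
        (vertLift (⟨q, a⟩ : TotalSpace F E) ζ)) 0 := by
  -- The chain rule asks for the differential at the point of parameter `0`, which equals `a` only
  -- after rewriting.
  have h0 : (⟨q, a + (0 : ℝ) • ζ⟩ : TotalSpace F E) = ⟨q, a⟩ := by rw [zero_smul, add_zero]
  have h1 : HasMFDerivAt (𝓘(ℝ, EQ).prod 𝓘(ℝ, F)) 𝓘(ℝ, ℝ) Φ
      (⟨q, a + (0 : ℝ) • ζ⟩ : TotalSpace F E)
      (mfderiv (𝓘(ℝ, EQ).prod 𝓘(ℝ, F)) 𝓘(ℝ, ℝ) Φ ⟨q, a⟩ : EQ × F →L[ℝ] ℝ) := by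
    rw [h0]; exact hΦ.hasMFDerivAt
  have h2 := HasMFDerivAt.comp (0 : ℝ) h1 (hasMFDerivAt_fiberLine (EQ := EQ) q a ζ)
  have h3 : HasFDerivAt (fun t : ℝ => Φ ⟨q, a + t • ζ⟩) _ 0 := hasMFDerivAt_iff_hasFDerivAt.1 h2
  set L : EQ × F →L[ℝ] ℝ := mfderiv (𝓘(ℝ, EQ).prod 𝓘(ℝ, F)) 𝓘(ℝ, ℝ) Φ ⟨q, a⟩
  set z : EQ × F := vertLift (EQ := EQ) (⟨q, a⟩ : TotalSpace F E) ζ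
  have h4 : (L ∘L (1 : ℝ →L[ℝ] ℝ).smulRight z) 1 = L z := by simp
  have h5 : HasDerivAt (fun t : ℝ => Φ ⟨q, a + t • ζ⟩)
    ((L ∘L (1 : ℝ →L[ℝ] ℝ).smulRight z) 1) 0 := HasFDerivAt.hasDerivAt h3
  rw [h4] at h5
  exact h5

lemma mfderiv_comp_section {Φ : TotalSpace F E → ℝ} {α : ∀ q, E q} {q : Q}
    (hΦ : MDifferentiableAt (𝓘(ℝ, EQ).prod 𝓘(ℝ, F)) 𝓘(ℝ, ℝ) Φ ⟨q, α q⟩)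
    (hα : MDifferentiableAt 𝓘(ℝ, EQ) (𝓘(ℝ, EQ).prod 𝓘(ℝ, F))
      (fun q => (⟨q, α q⟩ : TotalSpace F E)) q) (v : TangentSpace 𝓘(ℝ, EQ) q) :
    mfderiv (𝓘(ℝ, EQ).prod 𝓘(ℝ, F)) 𝓘(ℝ, ℝ) Φ ⟨q, α q⟩
      (mfderiv 𝓘(ℝ, EQ) (𝓘(ℝ, EQ).prod 𝓘(ℝ, F)) (fun q => (⟨q, α q⟩ : TotalSpace F E)) q v)
      = dirDeriv (fun q => Φ ⟨q, α q⟩) q v := by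
  have h := HasMFDerivAt.comp q (f := fun q => (⟨q, α q⟩ : TotalSpace F E))
    hΦ.hasMFDerivAt hα.hasMFDerivAt
  exact (congrArg (fun L : EQ →L[ℝ] ℝ => L v) h.mfderiv).symm

end TotalSpaceTangent

/-! ### Prescribing the value of a section and the differential of a function at a point -/

section Extension

variable {EQ : Type*} [NormedAddCommGroup EQ] [NormedSpace ℝ EQ] [FiniteDimensional ℝ EQ]
  {Q : Type*} [TopologicalSpace Q] [ChartedSpace EQ Q] [IsManifold 𝓘(ℝ, EQ) ∞ Q] [T2Space Q]
  {F : Type*} [NormedAddCommGroup F] [NormedSpace ℝ F]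
  {E : Q → Type*} [TopologicalSpace (TotalSpace F E)] [∀ q, TopologicalSpace (E q)]
  [∀ q, AddCommGroup (E q)] [∀ q, Module ℝ (E q)] [FiberBundle F E] [VectorBundle ℝ F E]
  [ContMDiffVectorBundle ∞ F E 𝓘(ℝ, EQ)]

/-- Every element of a vector bundle is the value of a smooth section. -/
lemma exists_section_eq (q : Q) (x : E q) : ∃ σ : Cₛ^∞⟮𝓘(ℝ, EQ); F, E⟯, σ q = x := by
  obtain ⟨s, hs, hσ⟩ := FiberBundle.exists_contMDiffOn_extend (k := ∞) 𝓘(ℝ, EQ) F x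
  obtain ⟨u, hus, hu, hqu⟩ := mem_nhds_iff.1 hs
  -- A bump function equal to `1` at `q` and supported where the local extension is smooth makes the
  -- product globally smooth without changing the value at `q`.
  obtain ⟨ψ, -, hψ⟩ :=
    (SmoothBumpFunction.nhds_basis_tsupport (I := 𝓘(ℝ, EQ)) q).mem_iff.1 (hu.mem_nhds hqu)
  refine ⟨⟨(ψ : Q → ℝ) • FiberBundle.extend F x, ?_⟩, ?_⟩
  · exact ContMDiffOn.smul_section_of_tsupport ψ.contMDiff.contMDiffOn hu hψ (hσ.mono hus)
  · change ψ q • FiberBundle.extend F x q = x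
    simp

/-- Every covector is the differential of a smooth function. -/
lemma exists_mfderiv_eq (q : Q) (L : TangentSpace 𝓘(ℝ, EQ) q →L[ℝ] ℝ) :
    ∃ f : C^∞⟮𝓘(ℝ, EQ), Q; ℝ⟯, mfderiv 𝓘(ℝ, EQ) 𝓘(ℝ, ℝ) f q = L := by
  obtain ⟨ψ⟩ : Nonempty (SmoothBumpFunction 𝓘(ℝ, EQ) q) := inferInstance
  let L' : EQ →L[ℝ] ℝ := L
  -- In the chart at `q` the function is the linear form itself. The differential of that chart at
  -- its own centre is the identity, so `g` has differential `L` at `q`.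
  let g : Q → ℝ := fun y => L' (extChartAt 𝓘(ℝ, EQ) q y)
  have hg : ContMDiffOn 𝓘(ℝ, EQ) 𝓘(ℝ, ℝ) ∞ g (chartAt EQ q).source :=
    L'.contMDiff.comp_contMDiffOn contMDiffOn_extChartAt
  refine ⟨⟨fun y => ψ y • g y, ψ.contMDiff_smul hg⟩, ?_⟩
  have h1 : (fun y => ψ y • g y) =ᶠ[nhds q] g := by
    filter_upwards [ψ.eventuallyEq_one] with y hy
    simp [hy]
  change mfderiv 𝓘(ℝ, EQ) 𝓘(ℝ, ℝ) (fun y => ψ y • g y) q = L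
  rw [h1.mfderiv_eq]
  have h2 : HasMFDerivAt 𝓘(ℝ, EQ) 𝓘(ℝ, ℝ) g q L := by
    have h3 := (mdifferentiableAt_extChartAt (I := 𝓘(ℝ, EQ)) (mem_chart_source EQ q)).hasMFDerivAt
    have h4 := HasMFDerivAt.comp q (L'.hasMFDerivAt) h3
    rw [show mfderiv 𝓘(ℝ, EQ) 𝓘(ℝ, EQ) (extChartAt 𝓘(ℝ, EQ) q) q
      = ContinuousLinearMap.id ℝ _ from ?_] at h4
    · exact h4
    · exact mfderiv_extChartAt_self
  exact h2.mfderiv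

end Extension

/-! ### Smoothness on dual bundles and of `μ` -/

section Smoothness

variable {EQ : Type*} [NormedAddCommGroup EQ] [NormedSpace ℝ EQ]
  {Q : Type*} [TopologicalSpace Q] [ChartedSpace EQ Q]
  {F : Type*} [NormedAddCommGroup F] [NormedSpace ℝ F]
  {E : Q → Type*} [TopologicalSpace (TotalSpace F E)] [∀ q, TopologicalSpace (E q)]
  [∀ q, AddCommGroup (E q)] [∀ q, Module ℝ (E q)] [FiberBundle F E] [VectorBundle ℝ F E]

/-- The evaluation of a smooth family of covectors on a smooth family of vectors is smooth. -/
lemma contMDiff_dual_apply {EM : Type*} [NormedAddCommGroup EM] [NormedSpace ℝ EM]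
    {HM : Type*} [TopologicalSpace HM] {IM : ModelWithCorners ℝ EM HM}
    {M : Type*} [TopologicalSpace M] [ChartedSpace HM M] {b : M → Q}
    {η : ∀ m, E (b m) →L[ℝ] ℝ} {v : ∀ m, E (b m)}
    (hη : ContMDiff IM (𝓘(ℝ, EQ).prod 𝓘(ℝ, F →L[ℝ] ℝ)) ∞
      (fun m => (⟨b m, η m⟩ : TotalSpace (F →L[ℝ] ℝ) (fun q => E q →L[ℝ] ℝ))))
    (hv : ContMDiff IM (𝓘(ℝ, EQ).prod 𝓘(ℝ, F)) ∞ (fun m => (⟨b m, v m⟩ : TotalSpace F E))) :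
    ContMDiff IM 𝓘(ℝ, ℝ) ∞ (fun m => η m (v m)) := by
  have h := ContMDiff.clm_bundle_apply (F₁ := F) (E₁ := E) (F₂ := ℝ) (E₂ := fun _ : Q => ℝ) hη hv
  intro m
  have := h m
  rw [contMDiffAt_totalSpace] at this
  exact this.2

lemma contMDiff_linBasic (σ : Cₛ^∞⟮𝓘(ℝ, EQ); F, E⟯) (f : C^∞⟮𝓘(ℝ, EQ), Q; ℝ⟯) :
    ContMDiff (𝓘(ℝ, EQ).prod 𝓘(ℝ, F →L[ℝ] ℝ)) 𝓘(ℝ, ℝ) ∞ (linBasic σ f) :=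
  (contMDiff_dual_apply contMDiff_id (σ.contMDiff.comp (contMDiff_proj _))).add
    (f.contMDiff.comp (contMDiff_proj _))

/-- A covector is trivialized by the transpose of the inverse trivialization of `E`; the trivial
line bundle in the target contributes the identity. -/
lemma dual_inCoordinates_apply (q₀ q : Q) (η : E q →L[ℝ] ℝ) (w : F) :
    ContinuousLinearMap.inCoordinates F E ℝ (fun _ : Q => ℝ) q₀ q q₀ q η w
      = η ((trivializationAt F E q₀).symmL ℝ q w) := by
  rw [ContinuousLinearMap.inCoordinates, ContinuousLinearMap.comp_apply,
    ContinuousLinearMap.comp_apply]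
  exact congrArg (fun L : ℝ →L[ℝ] ℝ => L (η ((trivializationAt F E q₀).symmL ℝ q w)))
    (Bundle.Trivial.continuousLinearMapAt_trivialization ℝ Q ℝ q)

/-- The trivialization of `ℝ × E` leaves the real component alone. This is what makes both `μ` and
`φ` constant in coordinates. -/
lemma symmL_prodReal (q₀ : Q) {q : Q} (hq : q ∈ (trivializationAt F E q₀).baseSet) (w : ℝ × F) :
    (trivializationAt (ℝ × F) (fun q : Q => ℝ × E q) q₀).symmL ℝ q w
      = (w.1, (trivializationAt F E q₀).symmL ℝ q w.2) := by
  set e := trivializationAt F E q₀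
  set e' := trivializationAt (ℝ × F) (fun q : Q => ℝ × E q) q₀
  have h := e'.symm_apply_apply_mk (b := q) ⟨Set.mem_univ _, hq⟩ (w.1, e.symm q w.2)
  rw [show (e' ⟨q, (w.1, e.symm q w.2)⟩).2 = (w.1, (e ⟨q, e.symm q w.2⟩).2) from rfl,
    e.apply_mk_symm hq] at h
  rw [e'.symmL_apply (R := ℝ) ⟨Set.mem_univ _, hq⟩, e.symmL_apply (R := ℝ) hq]
  exact h

-- In trivializations over a common base point `μ` is the fixed continuous linear map `T ↦ T ∘ inr`.
open AffineSystem in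
lemma contMDiff_mu : ContMDiff (𝓘(ℝ, EQ).prod 𝓘(ℝ, ℝ × F →L[ℝ] ℝ))
    (𝓘(ℝ, EQ).prod 𝓘(ℝ, F →L[ℝ] ℝ)) ∞ (mu : DualTilde F E → DualU F E) := by
  intro a
  rw [contMDiffAt_totalSpace]
  refine ⟨contMDiffAt_proj _, ?_⟩
  have h1 := (contMDiffAt_totalSpace.1 (contMDiffAt_id (x := a) (n := ∞)
    (I := 𝓘(ℝ, EQ).prod 𝓘(ℝ, ℝ × F →L[ℝ] ℝ)))).2
  have h2 : ContMDiff 𝓘(ℝ, ℝ × F →L[ℝ] ℝ) 𝓘(ℝ, F →L[ℝ] ℝ) ∞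
      (fun T : ℝ × F →L[ℝ] ℝ => T.comp (ContinuousLinearMap.inr ℝ ℝ F)) :=
    (((ContinuousLinearMap.compL ℝ F (ℝ × F) ℝ).flip
      (ContinuousLinearMap.inr ℝ ℝ F)).contMDiff)
  refine (h2.contMDiffAt.comp a h1).congr_of_eventuallyEq ?_
  have : ∀ᶠ b : DualTilde F E in nhds a, b.1 ∈ (trivializationAt F E a.1).baseSet :=
    (FiberBundle.continuous_proj _ _).continuousAt.preimage_mem_nhds
      ((trivializationAt F E a.1).open_baseSet.mem_nhds
        (FiberBundle.mem_baseSet_trivializationAt' a.1))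
  filter_upwards [this] with b hb
  ext w
  simp only [mu, Function.comp, id, hom_trivializationAt_apply]
  have h5 := symmL_prodReal a.1 hb ((0 : ℝ), w)
  rw [dual_inCoordinates_apply, ContinuousLinearMap.comp_apply, dual_inCoordinates_apply]
  exact (congrArg b.2 h5).symm

end Smoothness

/-! ### Smoothness of the metric isomorphism `U* → U` -/

section Sharp

variable {EQ : Type*} [NormedAddCommGroup EQ] [NormedSpace ℝ EQ]
  {Q : Type*} [TopologicalSpace Q] [ChartedSpace EQ Q]
  {F : Type*} [NormedAddCommGroup F] [NormedSpace ℝ F]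
  {E : Q → Type*} [TopologicalSpace (TotalSpace F E)] [∀ q, TopologicalSpace (E q)]
  [∀ q, AddCommGroup (E q)] [∀ q, Module ℝ (E q)] [FiberBundle F E] [VectorBundle ℝ F E]
  [∀ q, IsTopologicalAddGroup (E q)] [∀ q, ContinuousConstSMul ℝ (E q)]
  {FU : Type*} [NormedAddCommGroup FU] [NormedSpace ℝ FU] [FiniteDimensional ℝ FU]
  {U : Q → Type*} [TopologicalSpace (TotalSpace FU U)] [∀ q, TopologicalSpace (U q)]
  [∀ q, AddCommGroup (U q)] [∀ q, Module ℝ (U q)] [FiberBundle FU U] [VectorBundle ℝ FU U]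
  [ContMDiffVectorBundle ∞ FU U 𝓘(ℝ, EQ)]
  (G : Metric EQ F E) (S : Subbundle EQ FU U F E)

/-- A trivialization of `U`, followed by the inclusion into `E`, gives local smooth sections. -/
lemma contMDiffAt_incl_symm (q₀ : Q) (w : FU) :
    ContMDiffAt 𝓘(ℝ, EQ) (𝓘(ℝ, EQ).prod 𝓘(ℝ, F)) ∞
      (fun q => (⟨q, S.incl.toFun q ((trivializationAt FU U q₀).symm q w)⟩ : TotalSpace F E))
      q₀ := by
  set e := trivializationAt FU U q₀
  have hq₀ : q₀ ∈ e.baseSet := FiberBundle.mem_baseSet_trivializationAt' q₀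
  have h1 : ContMDiffAt 𝓘(ℝ, EQ) (𝓘(ℝ, EQ).prod 𝓘(ℝ, FU)) ∞
      (fun q => (⟨q, e.symm q w⟩ : TotalSpace FU U)) q₀ := by
    have h2 := (e.contMDiffOn_symm (IB := 𝓘(ℝ, EQ)) (n := ∞)).contMDiffAt (x := (q₀, w))
      (e.open_target.mem_nhds (by simp [e.mem_target, hq₀]))
    have h3 : ContMDiffAt 𝓘(ℝ, EQ) (𝓘(ℝ, EQ).prod 𝓘(ℝ, FU)) ∞ (fun q => (q, w)) q₀ :=
      contMDiffAt_id.prodMk contMDiffAt_const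
    refine (h2.comp q₀ h3).congr_of_eventuallyEq ?_
    filter_upwards [e.open_baseSet.mem_nhds hq₀] with q hq
    exact e.mk_symm hq w
  exact S.incl.smooth.contMDiffAt.comp q₀ h1

/-- The restriction of the metric to `U` in a trivialization of `U`. -/
lemma exists_contMDiffAt_subForm (q₀ : Q) :
    ∃ B : Q → FU →L[ℝ] FU →L[ℝ] ℝ, ContMDiffAt 𝓘(ℝ, EQ) 𝓘(ℝ, FU →L[ℝ] FU →L[ℝ] ℝ) ∞ B q₀ ∧
      ∀ q ∈ (trivializationAt FU U q₀).baseSet, ∀ w w' : FU,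
        B q w w' = subForm G S q ((trivializationAt FU U q₀).symm q w)
          ((trivializationAt FU U q₀).symm q w') := by
  set e := trivializationAt FU U q₀
  let b := Module.finBasis ℝ FU
  let s : FU → ∀ q, E q := fun w q => S.incl.toFun q (e.symm q w)
  have hval : ∀ w w' : FU,
      ContMDiffAt 𝓘(ℝ, EQ) 𝓘(ℝ, ℝ) ∞ (fun q => G.inner q (s w q) (s w' q)) q₀ := by
    intro w w'
    have := ContMDiffAt.clm_bundle_apply₂ (F₁ := F) (F₂ := F) (F₃ := ℝ)
      (E₃ := fun _ : Q => ℝ) G.contMDiff.contMDiffAt (contMDiffAt_incl_symm S q₀ w)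
      (contMDiffAt_incl_symm S q₀ w')
    rw [contMDiffAt_totalSpace] at this
    exact this.2
  -- The form is rebuilt from its Gram matrix in a basis of `FU`: finitely many smooth coefficients
  -- times constant forms.
  refine ⟨fun q => ∑ a, ∑ c, (G.inner q (s (b a) q) (s (b c) q) : ℝ) •
      (LinearMap.toContinuousLinearMap (b.coord a)).smulRight
        (LinearMap.toContinuousLinearMap (b.coord c)),
    ContMDiffAt.sum fun a _ => ContMDiffAt.sum fun c _ =>
      (hval (b a) (b c)).smul contMDiffAt_const, ?_⟩
  intro q hq w w'
  have hsl : ∀ w : FU, s w q = ∑ a, b.coord a w • s (b a) q := by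
    intro w
    conv_lhs => rw [← b.sum_repr w]
    simp only [s, ← e.symmL_apply (R := ℝ) hq, map_sum, map_smul, Module.Basis.coord_apply]
  change _ = G.inner q (s w q) (s w' q)
  rw [hsl w, hsl w']
  simp [Finset.mul_sum, mul_comm, mul_left_comm]
  exact Finset.sum_comm

/-- In a trivialization the map is `η ↦ B⁻¹ η`, with `B` the coordinate form of the metric on `U`,
and inversion of operators is smooth near an invertible one. -/
lemma contMDiff_sharp :
    ContMDiff (𝓘(ℝ, EQ).prod 𝓘(ℝ, FU →L[ℝ] ℝ)) (𝓘(ℝ, EQ).prod 𝓘(ℝ, FU)) ∞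
      (fun p : TotalSpace (FU →L[ℝ] ℝ) (fun q => U q →L[ℝ] ℝ) =>
        (⟨p.1, sharp G S p.1 p.2.toLinearMap⟩ : TotalSpace FU U)) := by
  intro p₀
  rw [contMDiffAt_totalSpace]
  refine ⟨contMDiffAt_proj _, ?_⟩
  set e := trivializationAt FU U p₀.1
  have hp₀ : p₀.1 ∈ e.baseSet := FiberBundle.mem_baseSet_trivializationAt' p₀.1
  obtain ⟨B, hB, hBv⟩ := exists_contMDiffAt_subForm G S p₀.1
  have hN := (contMDiffAt_totalSpace.1 (contMDiffAt_id (x := p₀) (n := ∞)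
    (I := 𝓘(ℝ, EQ).prod 𝓘(ℝ, FU →L[ℝ] ℝ)))).2
  have hinv : ∀ q ∈ e.baseSet, (B q).IsInvertible := by
    intro q hq
    have hinj : Function.Injective (B q) := by
      rw [injective_iff_map_eq_zero]
      intro w hw
      have h0 : e.symm q w = 0 := by
        refine (subForm_nondegenerate G S q).1 _ fun v => ?_
        have h1 := hBv q hq w (e ⟨q, v⟩).2
        rw [hw, e.symm_apply_apply_mk hq] at h1
        exact h1.symm
      have h1 := e.apply_mk_symm hq w
      rw [h0, show e (⟨q, 0⟩ : TotalSpace FU U) = (q, 0) from e.zeroSection ℝ hq] at h1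
      exact (Prod.ext_iff.1 h1).2.symm
    -- Injectivity is nondegeneracy of the metric; equality of dimensions upgrades it to
    -- invertibility.
    have hfin : Module.finrank ℝ FU = Module.finrank ℝ (FU →L[ℝ] ℝ) := by
      rw [← (LinearMap.toContinuousLinearMap (𝕜 := ℝ) (E := FU) (F' := ℝ)).finrank_eq]
      exact (Subspace.dual_finrank_eq (K := ℝ) (V := FU)).symm
    exact ⟨(LinearEquiv.ofInjectiveOfFinrankEq (B q).toLinearMap hinj hfin).toContinuousLinearEquiv,
      by ext; rfl⟩
  have h1 : ContMDiffAt 𝓘(ℝ, FU →L[ℝ] FU →L[ℝ] ℝ) 𝓘(ℝ, (FU →L[ℝ] ℝ) →L[ℝ] FU) ∞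
      ContinuousLinearMap.inverse (B p₀.1) :=
    ((hinv p₀.1 hp₀).contDiffAt_map_inverse).contMDiffAt
  have h2 := (h1.comp p₀.1 hB).comp p₀ (contMDiffAt_proj (n := ∞) (IB := 𝓘(ℝ, EQ))
    (fun q => U q →L[ℝ] ℝ) (p := p₀))
  refine (h2.clm_apply hN).congr_of_eventuallyEq ?_
  have : ∀ᶠ p : TotalSpace (FU →L[ℝ] ℝ) (fun q => U q →L[ℝ] ℝ) in nhds p₀, p.1 ∈ e.baseSet :=
    (FiberBundle.continuous_proj _ _).continuousAt.preimage_mem_nhds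
      (e.open_baseSet.mem_nhds hp₀)
  filter_upwards [this] with p hp
  have hBN : B p.1 (e ⟨p.1, sharp G S p.1 p.2.toLinearMap⟩).2
      = (trivializationAt (FU →L[ℝ] ℝ) (fun q => U q →L[ℝ] ℝ) p₀.1 p).2 := by
    ext w
    rw [hBv p.1 hp, e.symm_apply_apply_mk hp, hom_trivializationAt_apply]
    refine (sharp_spec G S p.1 _ _).trans ?_
    rw [← e.symmL_apply (R := ℝ) hp]
    exact (dual_inCoordinates_apply p₀.1 p.1 p.2 w).symm
  obtain ⟨L, hL⟩ := hinv p.1 hp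
  simp only [Function.comp, id]
  rw [← hBN, ← hL, ContinuousLinearMap.inverse_equiv]
  simp

end Sharp

/-! ### Covectors of a dual bundle as differentials of `σ̂ + f ∘ τ` -/

section Covectors

variable {EQ : Type*} [NormedAddCommGroup EQ] [NormedSpace ℝ EQ] [FiniteDimensional ℝ EQ]
  {Q : Type*} [TopologicalSpace Q] [ChartedSpace EQ Q] [IsManifold 𝓘(ℝ, EQ) ∞ Q] [T2Space Q]
  {F : Type*} [NormedAddCommGroup F] [NormedSpace ℝ F] [FiniteDimensional ℝ F]
  {E : Q → Type*} [TopologicalSpace (TotalSpace F E)] [∀ q, TopologicalSpace (E q)]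
  [∀ q, AddCommGroup (E q)] [∀ q, Module ℝ (E q)] [FiberBundle F E] [VectorBundle ℝ F E]
  [ContMDiffVectorBundle ∞ F E 𝓘(ℝ, EQ)]

/-- On a fibre `σ̂` is linear and `f ∘ τ` is constant. -/
lemma mfderiv_linBasic_vertLift (σ : Cₛ^∞⟮𝓘(ℝ, EQ); F, E⟯) (f : C^∞⟮𝓘(ℝ, EQ), Q; ℝ⟯) (q : Q)
    (a ζ : E q →L[ℝ] ℝ) :
    mfderiv (𝓘(ℝ, EQ).prod 𝓘(ℝ, F →L[ℝ] ℝ)) 𝓘(ℝ, ℝ) (linBasic σ f)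
      (⟨q, a⟩ : TotalSpace (F →L[ℝ] ℝ) (fun q => E q →L[ℝ] ℝ)) 
        (vertLift (F := F →L[ℝ] ℝ) (E := fun q => E q →L[ℝ] ℝ) ⟨q, a⟩ ζ) = ζ (σ q) := by
  have h1 := hasDerivAt_fiberLine
    ((contMDiff_linBasic σ f).mdifferentiable (by simp) ⟨q, a⟩) ζ
  have h2 : HasDerivAt (fun t : ℝ => (a + t • ζ) (σ q) + f q) (ζ (σ q)) 0 := by
    have := (((hasDerivAt_id (0 : ℝ)).mul_const (ζ (σ q))).const_add (a (σ q))).add_const (f q)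
    simpa using this
  exact h1.unique h2

/-- The restriction of a covector at a point of `E_q*` to the vertical vectors is the evaluation
at an element of `E_q`. -/
lemma exists_vertLift_eq_eval (q : Q) (a : E q →L[ℝ] ℝ)
    (ξ : TangentSpace (𝓘(ℝ, EQ).prod 𝓘(ℝ, F →L[ℝ] ℝ))
      (⟨q, a⟩ : TotalSpace (F →L[ℝ] ℝ) (fun q => E q →L[ℝ] ℝ)) →L[ℝ] ℝ) :
    ∃ x : E q, ∀ ζ : E q →L[ℝ] ℝ, ξ 
        (vertLift (F := F →L[ℝ] ℝ) (E := fun q => E q →L[ℝ] ℝ) ⟨q, a⟩ ζ) = ζ x := by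
  let e := trivializationAt F E q
  have hq : q ∈ e.baseSet := FiberBundle.mem_baseSet_trivializationAt' q
  let ξ' : EQ × (F →L[ℝ] ℝ) →L[ℝ] ℝ := ξ
  -- The vertical part of `ξ` is an element of the bidual of `F`, hence an evaluation, by finite
  -- dimension.
  let l : Module.Dual ℝ (Module.Dual ℝ F) :=
    ξ'.toLinearMap ∘ₗ LinearMap.inr ℝ EQ (F →L[ℝ] ℝ) ∘ₗ
      (LinearMap.toContinuousLinearMap (𝕜 := ℝ) (E := F) (F' := ℝ)).toLinearMap
  refine ⟨e.symm q ((Module.evalEquiv ℝ F).symm l), fun ζ => ?_⟩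
  rw [vertLift_apply, hom_trivializationAt_apply]
  set η := ContinuousLinearMap.inCoordinates F E ℝ (fun _ : Q => ℝ) q q q q ζ with hη
  have h1 : η ((Module.evalEquiv ℝ F).symm l) = l η.toLinearMap :=
    Module.apply_evalEquiv_symm_apply (R := ℝ) (M := F) η.toLinearMap l
  rw [hη, dual_inCoordinates_apply, e.symmL_apply (R := ℝ) hq] at h1
  rw [h1]
  rfl

/-- Every covector of `E*` is the differential of a function `σ̂ + f ∘ τ`. -/
lemma exists_mfderiv_linBasic_eq (α : Cₛ^∞⟮𝓘(ℝ, EQ); F →L[ℝ] ℝ, fun q => E q →L[ℝ] ℝ⟯) (q : Q)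
    (ξ : TangentSpace (𝓘(ℝ, EQ).prod 𝓘(ℝ, F →L[ℝ] ℝ))
      (⟨q, α q⟩ : TotalSpace (F →L[ℝ] ℝ) (fun q => E q →L[ℝ] ℝ)) →L[ℝ] ℝ) :
    ∃ (σ : Cₛ^∞⟮𝓘(ℝ, EQ); F, E⟯) (f : C^∞⟮𝓘(ℝ, EQ), Q; ℝ⟯),
      mfderiv (𝓘(ℝ, EQ).prod 𝓘(ℝ, F →L[ℝ] ℝ)) 𝓘(ℝ, ℝ) (linBasic σ f)
        (⟨q, α q⟩ : TotalSpace (F →L[ℝ] ℝ) (fun q => E q →L[ℝ] ℝ)) = ξ := by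
  obtain ⟨x, hx⟩ := exists_vertLift_eq_eval q (α q) ξ
  obtain ⟨σ, hσ⟩ := exists_section_eq (EQ := EQ) (F := F) q x
  have hα := α.mdifferentiable q
  let D : EQ →L[ℝ] EQ × (F →L[ℝ] ℝ) := mfderiv 𝓘(ℝ, EQ) (𝓘(ℝ, EQ).prod 𝓘(ℝ, F →L[ℝ] ℝ))
    (fun q => (⟨q, α q⟩ : TotalSpace (F →L[ℝ] ℝ) (fun q => E q →L[ℝ] ℝ))) q
  let ξ' : EQ × (F →L[ℝ] ℝ) →L[ℝ] ℝ := ξ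
  let P : EQ →L[ℝ] ℝ := mfderiv 𝓘(ℝ, EQ) 𝓘(ℝ, ℝ) (pairing α σ) q
  -- The vertical part of `ξ` has fixed `σ(q)`. Along the section `α` the function `σ̂` contributes
  -- the differential `P` of `α(σ)`, and `f` supplies the rest of `ξ` there.
  obtain ⟨f, hf⟩ := exists_mfderiv_eq (EQ := EQ) q (ξ' ∘L D - P)
  refine ⟨σ, f, covector_ext hα (fun v => ?_) fun ζ => ?_⟩
  swap
  · exact (mfderiv_linBasic_vertLift σ f q (α q) ζ).trans (by rw [hσ]; exact (hx ζ).symm)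
  refine (mfderiv_comp_section
    ((contMDiff_linBasic σ f).mdifferentiable (by simp) _) hα v).trans ?_
  have h1 := dirDeriv_add (pairing α σ) f q v
  have h2 : dirDeriv f q v = ξ' (D v) - P v :=
    congrArg (fun L : EQ →L[ℝ] ℝ => L v) hf
  have h3 : dirDeriv (pairing α σ) q v = P v := rfl
  rw [h2, h3, add_sub_cancel] at h1
  exact h1

end Covectors

/-! ### Continuous linear forms on a fibre -/

section FiberDuality

variable {Q : Type*} [TopologicalSpace Q]

/-- The fibres carry no norm, so Hahn–Banach is applied in the model fibre and transported by a
trivialization. -/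
lemma fiber_eq_of_forall_dual
    (F : Type*) [NormedAddCommGroup F] [NormedSpace ℝ F]
    {E : Q → Type*} [TopologicalSpace (TotalSpace F E)] [∀ q, TopologicalSpace (E q)]
    [∀ q, AddCommGroup (E q)] [∀ q, Module ℝ (E q)] [FiberBundle F E] [VectorBundle ℝ F E]
    {q : Q} {x y : E q} (h : ∀ ζ : E q →L[ℝ] ℝ, ζ x = ζ y) : x = y := by
  let L := (trivializationAt F E q).continuousLinearEquivAt ℝ q
    (FiberBundle.mem_baseSet_trivializationAt' q)
  refine L.injective ((SeparatingDual.eq_iff_forall_dual_eq (R := ℝ)).2 fun f => ?_)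
  exact h (f.comp (L : E q →L[ℝ] F))

lemma exists_continuousLinearMap_eq
    (F : Type*) [NormedAddCommGroup F] [NormedSpace ℝ F] [FiniteDimensional ℝ F]
    {E : Q → Type*} [TopologicalSpace (TotalSpace F E)] [∀ q, TopologicalSpace (E q)]
    [∀ q, AddCommGroup (E q)] [∀ q, Module ℝ (E q)] [FiberBundle F E] [VectorBundle ℝ F E]
    {q : Q} (l : E q →ₗ[ℝ] ℝ) :
    ∃ η : E q →L[ℝ] ℝ, ∀ u, η u = l u := by
  let L := (trivializationAt F E q).continuousLinearEquivAt ℝ q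
    (FiberBundle.mem_baseSet_trivializationAt' q)
  refine ⟨(LinearMap.toContinuousLinearMap (l ∘ₗ L.symm.toLinearMap)).comp (L : E q →L[ℝ] F),
    fun u => ?_⟩
  simp

end FiberDuality

/-! ### The almost Poisson bracket along a cocycle -/

section Poisson

variable {EQ : Type*} [NormedAddCommGroup EQ] [NormedSpace ℝ EQ] [FiniteDimensional ℝ EQ]
  {Q : Type*} [TopologicalSpace Q] [ChartedSpace EQ Q] [IsManifold 𝓘(ℝ, EQ) ∞ Q] [T2Space Q]
  {F : Type*} [NormedAddCommGroup F] [NormedSpace ℝ F] [FiniteDimensional ℝ F]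
  {E : Q → Type*} [TopologicalSpace (TotalSpace F E)] [∀ q, TopologicalSpace (E q)]
  [∀ q, AddCommGroup (E q)] [∀ q, Module ℝ (E q)] [FiberBundle F E] [VectorBundle ℝ F E]
  [ContMDiffVectorBundle ∞ F E 𝓘(ℝ, EQ)]

/-- The pull-back of `σ̂ + f ∘ τ` by `α` is `α(σ) + f`, and by the chain rule the differential of `Φ
∘ α` at `q` depends on `Φ` only through its differential at `α(q)`. -/
lemma dirDeriv_linBasic_section (α : Cₛ^∞⟮𝓘(ℝ, EQ); F →L[ℝ] ℝ, fun q => E q →L[ℝ] ℝ⟯)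
    (σ : Cₛ^∞⟮𝓘(ℝ, EQ); F, E⟯) (f : C^∞⟮𝓘(ℝ, EQ), Q; ℝ⟯) {q : Q}
    {Φ : TotalSpace (F →L[ℝ] ℝ) (fun q => E q →L[ℝ] ℝ) → ℝ}
    (hΦ : MDifferentiableAt (𝓘(ℝ, EQ).prod 𝓘(ℝ, F →L[ℝ] ℝ)) 𝓘(ℝ, ℝ) Φ ⟨q, α q⟩)
    (h : mfderiv (𝓘(ℝ, EQ).prod 𝓘(ℝ, F →L[ℝ] ℝ)) 𝓘(ℝ, ℝ) Φ ⟨q, α q⟩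
        = mfderiv (𝓘(ℝ, EQ).prod 𝓘(ℝ, F →L[ℝ] ℝ)) 𝓘(ℝ, ℝ) (linBasic σ f) ⟨q, α q⟩)
    (v : TangentSpace 𝓘(ℝ, EQ) q) :
    dirDeriv (fun q => Φ ⟨q, α q⟩) q v = dirDeriv (pairing α σ) q v + dirDeriv f q v := by
  have hα := α.mdifferentiable q
  rw [← mfderiv_comp_section hΦ hα, ← dirDeriv_add]
  refine Eq.trans ?_ (mfderiv_comp_section
    ((contMDiff_linBasic σ f).mdifferentiable (by simp) _) hα v)
  exact congrArg (fun L : EQ × (F →L[ℝ] ℝ) →L[ℝ] ℝ => L (mfderiv 𝓘(ℝ, EQ)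
    (𝓘(ℝ, EQ).prod 𝓘(ℝ, F →L[ℝ] ℝ))
    (fun q => (⟨q, α q⟩ : TotalSpace (F →L[ℝ] ℝ) (fun q => E q →L[ℝ] ℝ))) q v)) h

/-- The almost Poisson bracket along a `1`-cocycle `α`: if `x` and `y` are the fibre derivatives
of `Φ` and `Ψ`, then `{Φ, Ψ} ∘ α = ρ(y)(Φ ∘ α) - ρ(x)(Ψ ∘ α)`. -/
lemma SkewAlgebroid.poisson_cocycle (A : SkewAlgebroid EQ F E)
    {α : Cₛ^∞⟮𝓘(ℝ, EQ); F →L[ℝ] ℝ, fun q => E q →L[ℝ] ℝ⟯} (hα : A.IsCocycle α) {q : Q}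
    {Φ Ψ : TotalSpace (F →L[ℝ] ℝ) (fun q => E q →L[ℝ] ℝ) → ℝ}
    (hΦ : MDifferentiableAt (𝓘(ℝ, EQ).prod 𝓘(ℝ, F →L[ℝ] ℝ)) 𝓘(ℝ, ℝ) Φ ⟨q, α q⟩)
    (hΨ : MDifferentiableAt (𝓘(ℝ, EQ).prod 𝓘(ℝ, F →L[ℝ] ℝ)) 𝓘(ℝ, ℝ) Ψ ⟨q, α q⟩)
    {x y : E q}
    (hx : ∀ ζ : E q →L[ℝ] ℝ, HasDerivAt (fun t : ℝ => Φ ⟨q, α q + t • ζ⟩) (ζ x) 0)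
    (hy : ∀ ζ : E q →L[ℝ] ℝ, HasDerivAt (fun t : ℝ => Ψ ⟨q, α q + t • ζ⟩) (ζ y) 0) :
    A.poisson Φ Ψ ⟨q, α q⟩
      = dirDeriv (fun q => Φ ⟨q, α q⟩) q (A.anchor.toFun q y)
        - dirDeriv (fun q => Ψ ⟨q, α q⟩) q (A.anchor.toFun q x) := by
  -- Comparing vertical derivatives: the fibre derivative of a function is the value at `q` of any
  -- section representing its differential.
  have key : ∀ {Θ : TotalSpace (F →L[ℝ] ℝ) (fun q => E q →L[ℝ] ℝ) → ℝ} {z : E q}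
      {σ : Cₛ^∞⟮𝓘(ℝ, EQ); F, E⟯} {f : C^∞⟮𝓘(ℝ, EQ), Q; ℝ⟯}
      (_ : MDifferentiableAt (𝓘(ℝ, EQ).prod 𝓘(ℝ, F →L[ℝ] ℝ)) 𝓘(ℝ, ℝ) Θ ⟨q, α q⟩)
      (_ : ∀ ζ : E q →L[ℝ] ℝ, HasDerivAt (fun t : ℝ => Θ ⟨q, α q + t • ζ⟩) (ζ z) 0)
      (_ : mfderiv (𝓘(ℝ, EQ).prod 𝓘(ℝ, F →L[ℝ] ℝ)) 𝓘(ℝ, ℝ) Θ ⟨q, α q⟩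
        = mfderiv (𝓘(ℝ, EQ).prod 𝓘(ℝ, F →L[ℝ] ℝ)) 𝓘(ℝ, ℝ) (linBasic σ f) ⟨q, α q⟩),
      σ q = z := by
    intro Θ z σ f hΘ hz h
    refine fiber_eq_of_forall_dual F fun ζ => ?_
    refine Eq.trans ?_ ((hasDerivAt_fiberLine hΘ ζ).unique (hz ζ))
    refine (mfderiv_linBasic_vertLift σ f q (α q) ζ).symm.trans ?_
    exact congrArg (fun L : EQ × (F →L[ℝ] ℝ) →L[ℝ] ℝ =>
      L (vertLift (F := F →L[ℝ] ℝ) (E := fun q => E q →L[ℝ] ℝ) ⟨q, α q⟩ ζ)) h.symm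
  have hspec := Classical.epsilon_spec (p := fun r : ℝ =>
    ∀ (σ γ : Cₛ^∞⟮𝓘(ℝ, EQ); F, E⟯) (f g : C^∞⟮𝓘(ℝ, EQ), Q; ℝ⟯),
      mfderiv (𝓘(ℝ, EQ).prod 𝓘(ℝ, F →L[ℝ] ℝ)) 𝓘(ℝ, ℝ) Φ ⟨q, α q⟩
        = mfderiv (𝓘(ℝ, EQ).prod 𝓘(ℝ, F →L[ℝ] ℝ)) 𝓘(ℝ, ℝ) (linBasic σ f) ⟨q, α q⟩ →
      mfderiv (𝓘(ℝ, EQ).prod 𝓘(ℝ, F →L[ℝ] ℝ)) 𝓘(ℝ, ℝ) Ψ ⟨q, α q⟩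
        = mfderiv (𝓘(ℝ, EQ).prod 𝓘(ℝ, F →L[ℝ] ℝ)) 𝓘(ℝ, ℝ) (linBasic γ g) ⟨q, α q⟩ →
      r = -(α q (A.bracket σ γ q)) + A.deriv γ f q - A.deriv σ g q)
  -- The claimed value meets the defining relation for every choice of representatives; this is
  -- where `dα = 0` replaces the bracket term.
  have hr : ∀ (σ γ : Cₛ^∞⟮𝓘(ℝ, EQ); F, E⟯) (f g : C^∞⟮𝓘(ℝ, EQ), Q; ℝ⟯),
      mfderiv (𝓘(ℝ, EQ).prod 𝓘(ℝ, F →L[ℝ] ℝ)) 𝓘(ℝ, ℝ) Φ ⟨q, α q⟩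
        = mfderiv (𝓘(ℝ, EQ).prod 𝓘(ℝ, F →L[ℝ] ℝ)) 𝓘(ℝ, ℝ) (linBasic σ f) ⟨q, α q⟩ →
      mfderiv (𝓘(ℝ, EQ).prod 𝓘(ℝ, F →L[ℝ] ℝ)) 𝓘(ℝ, ℝ) Ψ ⟨q, α q⟩
        = mfderiv (𝓘(ℝ, EQ).prod 𝓘(ℝ, F →L[ℝ] ℝ)) 𝓘(ℝ, ℝ) (linBasic γ g) ⟨q, α q⟩ →
      dirDeriv (fun q => Φ ⟨q, α q⟩) q (A.anchor.toFun q y)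
        - dirDeriv (fun q => Ψ ⟨q, α q⟩) q (A.anchor.toFun q x)
        = -(α q (A.bracket σ γ q)) + A.deriv γ f q - A.deriv σ g q := by
    intro σ γ f g hσ hγ
    rw [dirDeriv_linBasic_section α σ f hΦ hσ, dirDeriv_linBasic_section α γ g hΨ hγ,
      ← key hΦ hx hσ, ← key hΨ hy hγ]
    have h0 : dirDeriv (pairing α γ) q (A.anchor.toFun q (σ q))
      - dirDeriv (pairing α σ) q (A.anchor.toFun q (γ q)) - α q (A.bracket σ γ q) = 0 := hα σ γ q
    change _ = -(α q (A.bracket σ γ q)) + dirDeriv f q (A.anchor.toFun q (γ q))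
      - dirDeriv g q (A.anchor.toFun q (σ q))
    linarith
  -- Representatives exist, so the relation pins down a single number and `epsilon` must return it.
  obtain ⟨σ, f, hσ⟩ := exists_mfderiv_linBasic_eq α q
    (mfderiv (𝓘(ℝ, EQ).prod 𝓘(ℝ, F →L[ℝ] ℝ)) 𝓘(ℝ, ℝ) Φ ⟨q, α q⟩ : EQ × (F →L[ℝ] ℝ) →L[ℝ] ℝ)
  obtain ⟨γ, g, hγ⟩ := exists_mfderiv_linBasic_eq α q
    (mfderiv (𝓘(ℝ, EQ).prod 𝓘(ℝ, F →L[ℝ] ℝ)) 𝓘(ℝ, ℝ) Ψ ⟨q, α q⟩ : EQ × (F →L[ℝ] ℝ) →L[ℝ] ℝ)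
  exact (hspec ⟨_, hr⟩ σ γ f g hσ.symm hγ.symm).trans (hr σ γ f g hσ.symm hγ.symm).symm

end Poisson

/-- The derivative of a function on a vector bundle along the vertical lift of `ζ`. -/
def vertDeriv (EQ : Type*) [NormedAddCommGroup EQ] [NormedSpace ℝ EQ]
    {Q : Type*} [TopologicalSpace Q] [ChartedSpace EQ Q]
    {F : Type*} [NormedAddCommGroup F] [NormedSpace ℝ F]
    {E : Q → Type*} [TopologicalSpace (TotalSpace F E)] [∀ q, TopologicalSpace (E q)]
    [∀ q, AddCommGroup (E q)] [∀ q, Module ℝ (E q)] [FiberBundle F E] [VectorBundle ℝ F E]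
    (Φ : TotalSpace F E → ℝ) {q : Q} (a ζ : E q) : ℝ :=
  mfderiv (𝓘(ℝ, EQ).prod 𝓘(ℝ, F)) 𝓘(ℝ, ℝ) Φ ⟨q, a⟩ (vertLift (⟨q, a⟩ : TotalSpace F E) ζ)

namespace AffineSystem

/-! ### The sections `φ`, `β + c φ` and `(1, X₀)` -/

section Phi

variable {EQ : Type*} [NormedAddCommGroup EQ] [NormedSpace ℝ EQ]
  {Q : Type*} [TopologicalSpace Q] [ChartedSpace EQ Q]
  {FU : Type*} [NormedAddCommGroup FU] [NormedSpace ℝ FU]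
  {U : Q → Type*} [TopologicalSpace (TotalSpace FU U)] [∀ q, TopologicalSpace (U q)]
  [∀ q, AddCommGroup (U q)] [∀ q, Module ℝ (U q)] [FiberBundle FU U] [VectorBundle ℝ FU U]

/-- The section `φ` of `𝒰⁺`. -/
def phiSection : Cₛ^∞⟮𝓘(ℝ, EQ); ℝ × FU →L[ℝ] ℝ, fun q => ℝ × U q →L[ℝ] ℝ⟯ :=
  ⟨fun q => phi q, by
    intro q₀
    rw [contMDiffAt_totalSpace]
    refine ⟨contMDiffAt_id, ?_⟩
    -- In the trivialization `φ` is the constant covector `fst`.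
    refine (contMDiffAt_const (c := ContinuousLinearMap.fst ℝ ℝ FU)).congr_of_eventuallyEq ?_
    filter_upwards [(trivializationAt FU U q₀).open_baseSet.mem_nhds
      (FiberBundle.mem_baseSet_trivializationAt' q₀)] with q hq
    refine ContinuousLinearMap.ext fun w => ?_
    rw [hom_trivializationAt_apply]
    refine (dual_inCoordinates_apply (F := ℝ × FU) (E := fun q : Q => ℝ × U q)
      q₀ q (phi q) w).trans ?_
    rw [symmL_prodReal q₀ hq]
    rfl⟩

/-- The section `β + c φ` of `𝒰⁺`. -/
def addPhi (β : Cₛ^∞⟮𝓘(ℝ, EQ); ℝ × FU →L[ℝ] ℝ, fun q => ℝ × U q →L[ℝ] ℝ⟯) (c : ℝ) :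
    Cₛ^∞⟮𝓘(ℝ, EQ); ℝ × FU →L[ℝ] ℝ, fun q => ℝ × U q →L[ℝ] ℝ⟯ :=
  β + c • phiSection (EQ := EQ) (FU := FU) (U := U)

/-- The section `(1, X₀)` of `Ũ`. -/
def oneX₀Section : Cₛ^∞⟮𝓘(ℝ, EQ); ℝ × FU, fun q => ℝ × U q⟯ :=
  pairSection (ContMDiffMap.const 1) 0

end Phi

variable {EQ : Type*} [NormedAddCommGroup EQ] [NormedSpace ℝ EQ]
  {Q : Type*} [TopologicalSpace Q] [ChartedSpace EQ Q] [IsManifold 𝓘(ℝ, EQ) ∞ Q]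
  {F : Type*} [NormedAddCommGroup F] [NormedSpace ℝ F]
  {E : Q → Type*} [TopologicalSpace (TotalSpace F E)] [∀ q, TopologicalSpace (E q)]
  [∀ q, AddCommGroup (E q)] [∀ q, Module ℝ (E q)] [FiberBundle F E] [VectorBundle ℝ F E]
  [∀ q, IsTopologicalAddGroup (E q)] [∀ q, ContinuousConstSMul ℝ (E q)]
  {FU : Type*} [NormedAddCommGroup FU] [NormedSpace ℝ FU] [FiniteDimensional ℝ FU]
  {U : Q → Type*} [TopologicalSpace (TotalSpace FU U)] [∀ q, TopologicalSpace (U q)]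
  [∀ q, AddCommGroup (U q)] [∀ q, Module ℝ (U q)] [FiberBundle FU U] [VectorBundle ℝ FU U]
  [ContMDiffVectorBundle ∞ FU U 𝓘(ℝ, EQ)]
  (M : AffineSystem EQ F E FU U) (A : SkewAlgebroid EQ F E)

/-! ### The Hamiltonian -/

lemma dualMetric_eq (q : Q) (η ζ : U q →L[ℝ] ℝ) :
    M.dualMetric q η ζ = ζ (sharp M.metric M.sub q η.toLinearMap) := by
  unfold dualMetric
  rw [M.metric.symm]
  exact sharp_spec M.metric M.sub q _ _

lemma dualMetric_comm (q : Q) (η ζ : U q →L[ℝ] ℝ) :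
    M.dualMetric q η ζ = M.dualMetric q ζ η := M.metric.symm _ _ _

lemma contMDiff_hamiltonian :
    ContMDiff (𝓘(ℝ, EQ).prod 𝓘(ℝ, FU →L[ℝ] ℝ)) 𝓘(ℝ, ℝ) ∞ M.hamiltonian := by
  have h1 : ContMDiff (𝓘(ℝ, EQ).prod 𝓘(ℝ, FU →L[ℝ] ℝ)) 𝓘(ℝ, ℝ) ∞
      (fun η : DualU FU U => M.dualMetric η.1 η.2 η.2) := by
    simp only [dualMetric_eq]
    exact contMDiff_dual_apply contMDiff_id (contMDiff_sharp M.metric M.sub)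
  exact (contMDiff_const.mul h1).add (M.potential.contMDiff.comp (contMDiff_proj _))

/-- On a fibre `H` is half a quadratic form plus a constant. Its expansion in `t` has linear
coefficient `𝒢_{U*}(η, ζ) = ζ(η^♯)`, so the fibre derivative of `H` is `η^♯`. -/
lemma hasDerivAt_hamiltonian (q : Q) (η ζ : U q →L[ℝ] ℝ) :
    HasDerivAt (fun t : ℝ => M.hamiltonian ⟨q, η + t • ζ⟩)
      (ζ (sharp M.metric M.sub q η.toLinearMap)) 0 := by
  have h1 : ∀ t : ℝ, M.hamiltonian ⟨q, η + t • ζ⟩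
      = 1 / 2 * (M.dualMetric q η η + t * (2 * M.dualMetric q η ζ)
        + t ^ 2 * M.dualMetric q ζ ζ) + M.potential q := by
    intro t
    have h2 : M.dualMetric q (η + t • ζ) (η + t • ζ)
        = M.dualMetric q η η + t * (2 * M.dualMetric q η ζ) + t ^ 2 * M.dualMetric q ζ ζ := by
      have h3 : M.dualMetric q (η + t • ζ) (η + t • ζ)
          = M.dualMetric q η η + t * M.dualMetric q ζ η + t * M.dualMetric q η ζ
            + t ^ 2 * M.dualMetric q ζ ζ := by
        have hs : sharp M.metric M.sub q (η + t • ζ).toLinearMap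
          = sharp M.metric M.sub q η.toLinearMap + t • sharp M.metric M.sub q ζ.toLinearMap := by
          rw [← map_smul, ← map_add]; rfl
        simp only [dualMetric_eq, hs, map_add, map_smul, _root_.add_apply,
          _root_.smul_apply, smul_eq_mul]
        ring
      rw [h3, M.dualMetric_comm q ζ η]; ring
    change 1 / 2 * M.dualMetric q (η + t • ζ) (η + t • ζ) + M.potential q = _
    rw [h2]
  simp only [h1]
  rw [← dualMetric_eq]
  have h4 := (((((hasDerivAt_id (0 : ℝ)).mul_const (2 * M.dualMetric q η ζ)).const_add
    (M.dualMetric q η η)).add (((hasDerivAt_id (0 : ℝ)).pow 2).mul_const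
      (M.dualMetric q ζ ζ))).const_mul (1 / 2)).add_const (M.potential q)
  exact h4.congr_deriv (by simp)

lemma hamFunction_eq (a : DualTilde FU U) :
    M.hamFunction a = a.2 (oneX₀ a.1) + M.hamiltonian (mu a) := by
  simp [hamFunction, hamSectionFib, phi, oneX₀, mu]

lemma contMDiff_hamFunction :
    ContMDiff (𝓘(ℝ, EQ).prod 𝓘(ℝ, ℝ × FU →L[ℝ] ℝ)) 𝓘(ℝ, ℝ) ∞ M.hamFunction := by
  have h1 : ContMDiff (𝓘(ℝ, EQ).prod 𝓘(ℝ, ℝ × FU →L[ℝ] ℝ)) 𝓘(ℝ, ℝ) ∞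
      (fun a : DualTilde FU U => a.2 (oneX₀ a.1)) :=
    contMDiff_dual_apply contMDiff_id
      ((oneX₀Section (EQ := EQ) (FU := FU) (U := U)).contMDiff.comp (contMDiff_proj _))
  refine (h1.add (M.contMDiff_hamiltonian.comp contMDiff_mu)).congr fun a => ?_
  exact M.hamFunction_eq a

/-- The term `a(1, X₀)` of `F_h` is linear and contributes `(1, X₀)`, which is the pair `(1, 0)`
here; the term `H ∘ μ` contributes the sharp in the `U` component. -/
lemma hasDerivAt_hamFunction (q : Q) (a ζ : ℝ × U q →L[ℝ] ℝ) :
    HasDerivAt (fun t : ℝ => M.hamFunction ⟨q, a + t • ζ⟩)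
      (ζ ((1 : ℝ), sharp M.metric M.sub q (muFib q a).toLinearMap)) 0 := by
  have h1 := M.hasDerivAt_hamiltonian q (muFib q a) (muFib q ζ)
  have h2 : HasDerivAt (fun t : ℝ => (a + t • ζ) (oneX₀ q)) (ζ (oneX₀ q)) 0 := by
    have := (((hasDerivAt_id (0 : ℝ)).mul_const (ζ (oneX₀ q))).const_add (a (oneX₀ q)))
    simpa using this
  have h3 : ζ ((1 : ℝ), sharp M.metric M.sub q (muFib q a).toLinearMap)
      = ζ (oneX₀ q) + muFib q ζ (sharp M.metric M.sub q (muFib q a).toLinearMap) := by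
    simp [muFib, oneX₀, ← map_add]
  rw [h3]
  simp only [hamFunction_eq]
  exact h2.add h1

/-! ### Cocycles of `Ũ` -/

/-- The section `φ` is closed, because the real component of the bracket of `Ũ` is `ρ(s)(φ(t)) -
ρ(t)(φ(s))`. The fibres of `μ` are lines in the direction `φ`, so through every point of the fibre
over `μ(β(q))` there passes a cocycle with the same image under `μ`. -/
lemma isCocycle_addPhi {β : Cₛ^∞⟮𝓘(ℝ, EQ); ℝ × FU →L[ℝ] ℝ, fun q => ℝ × U q →L[ℝ] ℝ⟯}
    (hβ : (M.algebroidTilde A).IsCocycle β) (c : ℝ) :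
    (M.algebroidTilde A).IsCocycle (addPhi β c) := by
  intro s t q
  have h0 := hβ s t q
  have hp : ∀ s : Cₛ^∞⟮𝓘(ℝ, EQ); ℝ × FU, fun q => ℝ × U q⟯,
      pairing (addPhi β c) s = pairing β s + c • fstSection s := fun s => by
    ext q; rfl
  change dirDeriv (pairing (addPhi β c) t) q _
    - dirDeriv (pairing (addPhi β c) s) q _
    - pairing (addPhi β c) ((M.algebroidTilde A).bracket s t) q = 0
  rw [hp, hp, hp, dirDeriv_add, dirDeriv_add, dirDeriv_smul, dirDeriv_smul]
  change dirDeriv (pairing β t) q ((M.algebroidTilde A).anchor.toFun q (s q))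
    - dirDeriv (pairing β s) q ((M.algebroidTilde A).anchor.toFun q (t q))
    - pairing β ((M.algebroidTilde A).bracket s t) q = 0 at h0
  have h1 : fstSection ((M.algebroidTilde A).bracket s t) q
      = dirDeriv (fstSection t) q ((M.algebroidTilde A).anchor.toFun q (s q))
        - dirDeriv (fstSection s) q ((M.algebroidTilde A).anchor.toFun q (t q)) := rfl
  change _ - (pairing β ((M.algebroidTilde A).bracket s t) q
    + c * fstSection ((M.algebroidTilde A).bracket s t) q) = 0
  rw [h1]
  linear_combination h0

/-- The function `H ∘ μ ∘ β + β(1, X₀)`. -/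
def energy (β : Cₛ^∞⟮𝓘(ℝ, EQ); ℝ × FU →L[ℝ] ℝ, fun q => ℝ × U q →L[ℝ] ℝ⟯) :
    C^∞⟮𝓘(ℝ, EQ), Q; ℝ⟯ :=
  ⟨fun q => M.hamiltonian ⟨q, muFib q (β q)⟩ + β q (oneX₀ q),
    (M.contMDiff_hamiltonian.comp (contMDiff_mu.comp β.contMDiff)).add
      (pairing β oneX₀Section).contMDiff⟩

/-- The section `μ ∘ β` of `U*`. -/
def muSection (β : Cₛ^∞⟮𝓘(ℝ, EQ); ℝ × FU →L[ℝ] ℝ, fun q => ℝ × U q →L[ℝ] ℝ⟯) :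
    Cₛ^∞⟮𝓘(ℝ, EQ); FU →L[ℝ] ℝ, fun q => U q →L[ℝ] ℝ⟯ :=
  ⟨fun q => muFib q (β q), contMDiff_mu.comp β.contMDiff⟩

/-- The section `X₀ + (μ ∘ β)^♯` of `E`, whose image under the anchor is `R_h^{μ ∘ β}`. -/
def velocity (β : Cₛ^∞⟮𝓘(ℝ, EQ); ℝ × FU →L[ℝ] ℝ, fun q => ℝ × U q →L[ℝ] ℝ⟯) :
    Cₛ^∞⟮𝓘(ℝ, EQ); F, E⟯ :=
  -- The factor `1` is kept so that the value is literally the `E` component of the inclusion of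
  -- `(1, (μ ∘ β)^♯)`.
  ⟨fun q => (1 : ℝ) • M.X₀ q
      + M.sub.incl.toFun q (sharp M.metric M.sub q (muFib q (β q)).toLinearMap),
    contMDiff_smul_add (fun q => q) contMDiff_const M.X₀.contMDiff
      (M.sub.incl.smooth.comp ((contMDiff_sharp M.metric M.sub).comp (muSection β).contMDiff))⟩

/-- The kernel of `μ` on a fibre consists of the forms vanishing on all `(0, u)`, that is, of the
multiples of `φ`. -/
lemma eq_add_smul_phi {q : Q} {a b : ℝ × U q →L[ℝ] ℝ} (h : muFib q a = muFib q b) :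
    ∃ c : ℝ, a = b + c • phi q := by
  refine ⟨a (oneX₀ q) - b (oneX₀ q), ContinuousLinearMap.ext fun p => ?_⟩
  obtain ⟨r, u⟩ := p
  have h1 : ((r, u) : ℝ × U q) = r • oneX₀ q + (0, u) := by simp [oneX₀]
  have h2 : a ((0 : ℝ), u) = b ((0 : ℝ), u) := congrArg (fun L : U q →L[ℝ] ℝ => L u) h
  have h3 : phi q ((r, u) : ℝ × U q) = r := rfl
  rw [_root_.add_apply, _root_.smul_apply, h3, h1]
  simp only [map_add, map_smul, h2, smul_eq_mul]
  ring

/-! ### The Hamiltonian vector field along a cocycle -/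

variable [FiniteDimensional ℝ EQ] [T2Space Q]

/-- The right-hand side does not involve `a`, only `μ(a)`: this is why `R_h` is well defined along
`μ ∘ β`. The covector `η` is the differential of the energy restricted to `ρ(U)`. -/
lemma poisson_hamFunction {β : Cₛ^∞⟮𝓘(ℝ, EQ); ℝ × FU →L[ℝ] ℝ, fun q => ℝ × U q →L[ℝ] ℝ⟯}
    (hβ : (M.algebroidTilde A).IsCocycle β) {q : Q} {η : U q →L[ℝ] ℝ}
    (hη : ∀ u, η u = dirDeriv (M.energy β) q (A.anchor.toFun q (M.sub.incl.toFun q u)))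
    (Φ : C^∞⟮𝓘(ℝ, EQ).prod 𝓘(ℝ, FU →L[ℝ] ℝ), DualU FU U; ℝ⟯) {a : DualTilde FU U}
    (ha : mu a = ⟨q, muFib q (β q)⟩) :
    (M.algebroidTilde A).poisson (Φ ∘ mu) M.hamFunction a
      = dirDeriv (fun q => Φ ⟨q, muFib q (β q)⟩) q (A.anchor.toFun q (M.velocity β q))
        - vertDeriv EQ (F := FU →L[ℝ] ℝ) (E := fun q => U q →L[ℝ] ℝ) Φ (muFib q (β q)) η := by
  obtain ⟨q', a⟩ := a
  obtain rfl : q' = q := congrArg TotalSpace.proj ha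
  obtain ⟨c, rfl⟩ : ∃ c : ℝ, a = β q' + c • phi q' :=
    eq_add_smul_phi (TotalSpace.mk_injective (F := FU →L[ℝ] ℝ)
    (E := fun q => U q →L[ℝ] ℝ) q' ha)
  have hΦd : MDifferentiableAt (𝓘(ℝ, EQ).prod 𝓘(ℝ, FU →L[ℝ] ℝ)) 𝓘(ℝ, ℝ) Φ
    (⟨q', muFib q' (β q')⟩ : DualU FU U) := Φ.contMDiff.mdifferentiable (by simp) _
  -- Here `u` is the fibre derivative of `Φ`, so that `Φ ∘ μ` has fibre derivative `(0, u)`.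
  obtain ⟨u, hu⟩ := exists_vertLift_eq_eval (EQ := EQ) q' (muFib q' (β q'))
    (mfderiv (𝓘(ℝ, EQ).prod 𝓘(ℝ, FU →L[ℝ] ℝ)) 𝓘(ℝ, ℝ) Φ ⟨q', muFib q' (β q')⟩ :
      EQ × (FU →L[ℝ] ℝ) →L[ℝ] ℝ)
  have hmu : ∀ q, muFib q (addPhi β c q) = muFib q (β q) := by
    intro q
    refine ContinuousLinearMap.ext fun u => ?_
    change β q (0, u) + c * 0 = β q (0, u)
    ring
  have h := (M.algebroidTilde A).poisson_cocycle (M.isCocycle_addPhi A hβ c) (q := q')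
    (Φ := Φ ∘ mu) (Ψ := M.hamFunction) (x := ((0 : ℝ), u))
    (y := ((1 : ℝ), sharp M.metric M.sub q' (muFib q' (β q')).toLinearMap))
    ((Φ.contMDiff.comp contMDiff_mu).mdifferentiable (by simp) _)
    (M.contMDiff_hamFunction.mdifferentiable (by simp) _)
    (fun ζ => by
      have h1 := hasDerivAt_fiberLine hΦd (muFib q' ζ)
      have h2 : mfderiv (𝓘(ℝ, EQ).prod 𝓘(ℝ, FU →L[ℝ] ℝ)) 𝓘(ℝ, ℝ) Φ ⟨q', muFib q' (β q')⟩
        (vertLift (F := FU →L[ℝ] ℝ) (E := fun q => U q →L[ℝ] ℝ) ⟨q', muFib q' (β q')⟩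
          (muFib q' ζ)) = ζ (0, u) := hu _
      rw [h2] at h1
      rw [← hmu q'] at h1
      exact h1)
    (fun ζ => by
      have h1 := M.hasDerivAt_hamFunction q' (addPhi β c q') ζ
      rw [hmu q'] at h1
      exact h1)
  refine h.trans ?_
  congr 1
  · have h1 : (fun q => (Φ ∘ mu) ⟨q, addPhi β c q⟩) = fun q => Φ ⟨q, muFib q (β q)⟩ := by
      funext q
      change Φ ⟨q, muFib q _⟩ = _
      rw [hmu q]
    rw [h1]
    rfl
  · refine Eq.trans ?_ (hu η).symm
    rw [hη]
    -- Moving from `β` to `β + c φ` changes `F_h` by the constant `c`, which differentiation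
    -- removes.
    have h1 : (fun q => M.hamFunction ⟨q, addPhi β c q⟩)
        = (M.energy β + ContMDiffMap.const c : C^∞⟮𝓘(ℝ, EQ), Q; ℝ⟯) := by
      funext q
      rw [hamFunction_eq]
      change (β q (oneX₀ q) + c * 1) + M.hamiltonian ⟨q, muFib q _⟩
        = M.hamiltonian ⟨q, muFib q (β q)⟩ + β q (oneX₀ q) + c
      rw [hmu q]
      ring
    rw [h1, dirDeriv_add]
    have h2 : ∀ v, dirDeriv (ContMDiffMap.const c : C^∞⟮𝓘(ℝ, EQ), Q; ℝ⟯) q' v = 0 := fun v =>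
      congrArg (fun L : EQ →L[ℝ] ℝ => L v) (mfderiv_const (I := 𝓘(ℝ, EQ)) (c := c) (x := q'))
    rw [h2, add_zero]
    have h3 : (0 : ℝ) • M.X₀ q' + M.sub.incl.toFun q' u = M.sub.incl.toFun q' u := by
      rw [zero_smul, zero_add]
    exact congrArg (fun e => dirDeriv (M.energy β) q' (A.anchor.toFun q' e)) h3

/-- The Hamiltonian vector field along `μ ∘ β` for a cocycle `β`. -/
lemma hamVectorField_cocycle {β : Cₛ^∞⟮𝓘(ℝ, EQ); ℝ × FU →L[ℝ] ℝ, fun q => ℝ × U q →L[ℝ] ℝ⟯}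
    (hβ : (M.algebroidTilde A).IsCocycle β) {q : Q} {η : U q →L[ℝ] ℝ}
    (hη : ∀ u, η u = dirDeriv (M.energy β) q (A.anchor.toFun q (M.sub.incl.toFun q u))) :
    M.hamVectorField A ⟨q, muFib q (β q)⟩
      = mfderiv 𝓘(ℝ, EQ) (𝓘(ℝ, EQ).prod 𝓘(ℝ, FU →L[ℝ] ℝ))
          (fun q => (⟨q, muFib q (β q)⟩ : DualU FU U)) q (A.anchor.toFun q (M.velocity β q))
        - vertLift (F := FU →L[ℝ] ℝ) (E := fun q => U q →L[ℝ] ℝ) ⟨q, muFib q (β q)⟩ η := by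
  let v₀ : TangentSpace (𝓘(ℝ, EQ).prod 𝓘(ℝ, FU →L[ℝ] ℝ))
      (⟨q, muFib q (β q)⟩ : DualU FU U) := mfderiv 𝓘(ℝ, EQ) (𝓘(ℝ, EQ).prod 𝓘(ℝ, FU →L[ℝ] ℝ))
          (fun q => (⟨q, muFib q (β q)⟩ : DualU FU U)) q (A.anchor.toFun q (M.velocity β q))
        - vertLift (F := FU →L[ℝ] ℝ) (E := fun q => U q →L[ℝ] ℝ) ⟨q, muFib q (β q)⟩ η
  have hα := (muSection β).mdifferentiable q
  have hex : ∀ (Φ : C^∞⟮𝓘(ℝ, EQ).prod 𝓘(ℝ, FU →L[ℝ] ℝ), DualU FU U; ℝ⟯) (a : DualTilde FU U),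
      mu a = ⟨q, muFib q (β q)⟩ →
        mfderiv (𝓘(ℝ, EQ).prod 𝓘(ℝ, FU →L[ℝ] ℝ)) 𝓘(ℝ, ℝ) Φ ⟨q, muFib q (β q)⟩ v₀
          = (M.algebroidTilde A).poisson (Φ ∘ mu) M.hamFunction a := by
    intro Φ a ha
    rw [M.poisson_hamFunction A hβ hη Φ ha]
    have h1 := mfderiv_comp_section (Φ := Φ) (α := fun q => muFib q (β q)) (q := q)
      (Φ.contMDiff.mdifferentiable (by simp) _) hα (A.anchor.toFun q (M.velocity β q))
    rw [← h1]
    exact map_sub (mfderiv (𝓘(ℝ, EQ).prod 𝓘(ℝ, FU →L[ℝ] ℝ)) 𝓘(ℝ, ℝ) Φ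
      (⟨q, muFib q (β q)⟩ : DualU FU U)) _ _
  have : Nonempty (TangentSpace (𝓘(ℝ, EQ).prod 𝓘(ℝ, FU →L[ℝ] ℝ))
    (⟨q, muFib q (β q)⟩ : DualU FU U)) := ⟨0⟩
  have hspec := Classical.epsilon_spec
    (p := fun v : TangentSpace (𝓘(ℝ, EQ).prod 𝓘(ℝ, FU →L[ℝ] ℝ))
      (⟨q, muFib q (β q)⟩ : DualU FU U) =>
      ∀ (Φ : C^∞⟮𝓘(ℝ, EQ).prod 𝓘(ℝ, FU →L[ℝ] ℝ), DualU FU U; ℝ⟯) (a : DualTilde FU U),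
      mu a = ⟨q, muFib q (β q)⟩ →
        mfderiv (𝓘(ℝ, EQ).prod 𝓘(ℝ, FU →L[ℝ] ℝ)) 𝓘(ℝ, ℝ) Φ ⟨q, muFib q (β q)⟩ v
          = (M.algebroidTilde A).poisson (Φ ∘ mu) M.hamFunction a) ⟨v₀, hex⟩
  let v₁ : EQ × (FU →L[ℝ] ℝ) := M.hamVectorField A ⟨q, muFib q (β q)⟩
  -- Uniqueness: the vector chosen by `epsilon` and `v₀` agree on the differentials of the functions
  -- `σ̂ + f ∘ τ`, which are smooth and exhaust the covectors.
  refine (SeparatingDual.eq_iff_forall_dual_eq (R := ℝ) (V := EQ × (FU →L[ℝ] ℝ))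
    (x := v₁) (y := v₀)).2 fun ξ => ?_
  obtain ⟨σ, f, hσ⟩ := exists_mfderiv_linBasic_eq (muSection β) q ξ
  have h1 := (hspec ⟨linBasic σ f, contMDiff_linBasic σ f⟩ ⟨q, β q⟩ rfl).trans
    (hex ⟨linBasic σ f, contMDiff_linBasic σ f⟩ ⟨q, β q⟩ rfl).symm
  exact (congrArg (fun L : EQ × (FU →L[ℝ] ℝ) →L[ℝ] ℝ => L v₁) hσ).symm.trans
    (h1.trans (congrArg (fun L : EQ × (FU →L[ℝ] ℝ) →L[ℝ] ℝ => L v₀) hσ))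

lemma baseVectorField_cocycle
    {β : Cₛ^∞⟮𝓘(ℝ, EQ); ℝ × FU →L[ℝ] ℝ, fun q => ℝ × U q →L[ℝ] ℝ⟯}
    (hβ : (M.algebroidTilde A).IsCocycle β) (q : Q) :
    M.baseVectorField A (fun q => muFib q (β q)) q = A.anchor.toFun q (M.velocity β q) := by
  obtain ⟨η, hη⟩ := exists_continuousLinearMap_eq FU
    ((mfderiv 𝓘(ℝ, EQ) 𝓘(ℝ, ℝ) (M.energy β) q).toLinearMap ∘ₗ A.anchor.toFun q
      ∘ₗ M.sub.incl.toFun q)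
  unfold baseVectorField
  rw [M.hamVectorField_cocycle A hβ hη]
  refine (mfderiv_proj_sub_vertLift _ _ _).trans ?_
  exact mfderiv_proj_section ((muSection β).mdifferentiable q) _

end AffineSystem

/-! ### Functions that are constant along a completely nonholonomic distribution -/

section Nonholonomic

variable {EQ : Type*} [NormedAddCommGroup EQ] [NormedSpace ℝ EQ]
  {Q : Type*} [TopologicalSpace Q] [ChartedSpace EQ Q] [IsManifold 𝓘(ℝ, EQ) ∞ Q]

/-- In the Leibniz rule `[X, f Y] = X(f) Y + f [X, Y]` the first term drops out. -/
lemma mlieBracket_smul_of_dirDeriv_eq_zero [CompleteSpace EQ] (f : C^∞⟮𝓘(ℝ, EQ), Q; ℝ⟯)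
    {X Y : ∀ q : Q, TangentSpace 𝓘(ℝ, EQ) q}
    (hY : ContMDiff 𝓘(ℝ, EQ) 𝓘(ℝ, EQ).tangent ∞
      (fun q => (⟨q, Y q⟩ : TangentBundle 𝓘(ℝ, EQ) Q)))
    (hX : ∀ q, dirDeriv f q (X q) = 0) :
    VectorField.mlieBracket 𝓘(ℝ, EQ) X ((f : Q → ℝ) • Y)
      = (f : Q → ℝ) • VectorField.mlieBracket 𝓘(ℝ, EQ) X Y := by
  have : IsManifold 𝓘(ℝ, EQ) (minSmoothness ℝ 2) Q := by
    rw [minSmoothness_of_isRCLikeNormedField]; exact IsManifold.of_le (n := ∞) (by norm_cast)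
  funext q
  rw [VectorField.mlieBracket_smul_right (f.contMDiff.mdifferentiable (by simp) q)
    (hY.mdifferentiable (by simp) q)]
  have h : (mvfderiv 𝓘(ℝ, EQ) f q (X q)) = 0 := hX q
  rw [h, zero_smul, zero_add]
  rfl

lemma contMDiff_mlieBracket [CompleteSpace EQ] {X Y : ∀ q : Q, TangentSpace 𝓘(ℝ, EQ) q}
    (hX : ContMDiff 𝓘(ℝ, EQ) 𝓘(ℝ, EQ).tangent ∞
      (fun q => (⟨q, X q⟩ : TangentBundle 𝓘(ℝ, EQ) Q)))
    (hY : ContMDiff 𝓘(ℝ, EQ) 𝓘(ℝ, EQ).tangent ∞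
      (fun q => (⟨q, Y q⟩ : TangentBundle 𝓘(ℝ, EQ) Q))) :
    ContMDiff 𝓘(ℝ, EQ) 𝓘(ℝ, EQ).tangent ∞
      (fun q => (⟨q, VectorField.mlieBracket 𝓘(ℝ, EQ) X Y q⟩ : TangentBundle 𝓘(ℝ, EQ) Q)) := by
  have h2 : IsManifold 𝓘(ℝ, EQ) (minSmoothness ℝ 2) Q := by
    rw [minSmoothness_of_isRCLikeNormedField]; exact IsManifold.of_le (n := ∞) (by norm_cast)
  have h1 : IsManifold 𝓘(ℝ, EQ) (((⊤ : ℕ∞) : WithTop ℕ∞) + 1) Q := by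
    rw [show (((⊤ : ℕ∞) : WithTop ℕ∞) + 1) = ∞ from rfl]; infer_instance
  exact ContDiff.mlieBracket_vectorField (n := ⊤) (m := ⊤) hX hY
    (by rw [minSmoothness_of_isRCLikeNormedField]; rfl)

/-- If `X(f) = Y(f) = 0` then `[X, Y](f) = 0`. -/
lemma dirDeriv_mlieBracket_eq_zero [CompleteSpace EQ] (f : C^∞⟮𝓘(ℝ, EQ), Q; ℝ⟯)
    {X Y : ∀ q : Q, TangentSpace 𝓘(ℝ, EQ) q}
    (hX : ContMDiff 𝓘(ℝ, EQ) 𝓘(ℝ, EQ).tangent ∞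
      (fun q => (⟨q, X q⟩ : TangentBundle 𝓘(ℝ, EQ) Q)))
    (hY : ContMDiff 𝓘(ℝ, EQ) 𝓘(ℝ, EQ).tangent ∞
      (fun q => (⟨q, Y q⟩ : TangentBundle 𝓘(ℝ, EQ) Q)))
    (hfX : ∀ q, dirDeriv f q (X q) = 0) (hfY : ∀ q, dirDeriv f q (Y q) = 0) (q : Q) :
    dirDeriv f q (VectorField.mlieBracket 𝓘(ℝ, EQ) X Y q) = 0 := by
  have h2 : IsManifold 𝓘(ℝ, EQ) (minSmoothness ℝ 2) Q := by
    rw [minSmoothness_of_isRCLikeNormedField]; exact IsManifold.of_le (n := ∞) (by norm_cast)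
  have h3 : IsManifold 𝓘(ℝ, EQ) (minSmoothness ℝ 3) Q := by
    rw [minSmoothness_of_isRCLikeNormedField]; exact IsManifold.of_le (n := ∞) (by norm_cast)
  have hle : minSmoothness ℝ 2 ≤ (∞ : WithTop ℕ∞) := by
    rw [minSmoothness_of_isRCLikeNormedField]; norm_cast
  set Z := VectorField.mlieBracket 𝓘(ℝ, EQ) X Y with hZdef
  have hZ := contMDiff_mlieBracket hX hY
  have hfZ : ContMDiff 𝓘(ℝ, EQ) 𝓘(ℝ, EQ).tangent ∞
      (fun q => (⟨q, ((f : Q → ℝ) • Z) q⟩ : TangentBundle 𝓘(ℝ, EQ) Q)) :=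
    f.contMDiff.smul_section hZ
  -- With `Z = [X, Y]`, the Jacobi identity is applied to `X, Y, f Z` and to `X, Y, Z`. As `X` and
  -- `Y` annihilate `f`, the factor `f` comes out of every bracket with them; the comparison leaves
  -- only `Z(f) Z = 0`.
  have j1 := VectorField.leibniz_identity_mlieBracket (hX.of_le hle) (hY.of_le hle) (hfZ.of_le hle)
  have j2 := VectorField.leibniz_identity_mlieBracket (hX.of_le hle) (hY.of_le hle) (hZ.of_le hle)
  rw [mlieBracket_smul_of_dirDeriv_eq_zero f hZ hfY, mlieBracket_smul_of_dirDeriv_eq_zero f hZ hfX,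
    mlieBracket_smul_of_dirDeriv_eq_zero f (contMDiff_mlieBracket hY hZ) hfX,
    mlieBracket_smul_of_dirDeriv_eq_zero f (contMDiff_mlieBracket hX hZ) hfY, j2] at j1
  have j3 := congrFun j1 q
  have j4 := VectorField.mlieBracket_smul_right (V := Z)
    (f.contMDiff.mdifferentiable (by simp) q) (hZ.mdifferentiable (by simp) q)
  have j5 : f q • (VectorField.mlieBracket 𝓘(ℝ, EQ) Z Z q
      + VectorField.mlieBracket 𝓘(ℝ, EQ) Y (VectorField.mlieBracket 𝓘(ℝ, EQ) X Z) q)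
      = VectorField.mlieBracket 𝓘(ℝ, EQ) Z ((f : Q → ℝ) • Z) q
        + f q • VectorField.mlieBracket 𝓘(ℝ, EQ) Y (VectorField.mlieBracket 𝓘(ℝ, EQ) X Z) q := j3
  have j6 : VectorField.mlieBracket 𝓘(ℝ, EQ) Z ((f : Q → ℝ) • Z) q
      = dirDeriv f q (Z q) • Z q + f q • VectorField.mlieBracket 𝓘(ℝ, EQ) Z Z q := j4
  rw [j6, smul_add] at j5
  have j7 : dirDeriv f q (Z q) • Z q = 0 := by
    have := sub_eq_zero.2 j5
    rw [← neg_eq_zero, ← this]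
    abel
  -- At each point either `Z(f)` is zero already, or `Z` is zero there and so is `Z(f)`.
  rcases smul_eq_zero.1 j7 with h | h
  · exact h
  · rw [h]
    exact map_zero (mfderiv 𝓘(ℝ, EQ) 𝓘(ℝ, ℝ) f q)

/-- Smoothness is carried through the induction because the bracket step needs it for the inner
field. -/
lemma IteratedBracket.contMDiff_and_dirDeriv_eq_zero [CompleteSpace EQ] (f : C^∞⟮𝓘(ℝ, EQ), Q; ℝ⟯)
    {D : ∀ q : Q, Submodule ℝ (TangentSpace 𝓘(ℝ, EQ) q)}
    (hf : ∀ q, ∀ v ∈ D q, dirDeriv f q v = 0) {Y : ∀ q : Q, TangentSpace 𝓘(ℝ, EQ) q}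
    (hY : IteratedBracket D Y) :
    ContMDiff 𝓘(ℝ, EQ) 𝓘(ℝ, EQ).tangent ∞ (fun q => (⟨q, Y q⟩ : TangentBundle 𝓘(ℝ, EQ) Q)) ∧
      ∀ q, dirDeriv f q (Y q) = 0 := by
  induction hY with
  | base X hX hD => exact ⟨hX, fun q => hf q _ (hD q)⟩
  | lie X Y hX hD _ ih =>
    exact ⟨contMDiff_mlieBracket hX ih.1,
      dirDeriv_mlieBracket_eq_zero f hX ih.1 (fun q => hf q _ (hD q)) ih.2⟩

/-- On a ball inside the chart target the coordinate expression has zero derivative, and a ball is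
connected. -/
lemma isLocallyConstant_of_mfderiv_eq_zero (f : C^∞⟮𝓘(ℝ, EQ), Q; ℝ⟯)
    (hf : ∀ q, mfderiv 𝓘(ℝ, EQ) 𝓘(ℝ, ℝ) f q = 0) : IsLocallyConstant f := by
  rw [IsLocallyConstant.iff_eventually_eq]
  intro q
  set φ := extChartAt 𝓘(ℝ, EQ) q
  obtain ⟨ε, hε, hb⟩ := Metric.mem_nhds_iff.1
    (extChartAt_target_mem_nhds (I := 𝓘(ℝ, EQ)) q)
  have hd : ∀ y ∈ Metric.ball (φ q) ε, HasFDerivAt (f ∘ φ.symm) (0 : EQ →L[ℝ] ℝ) y := by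
    intro y hy
    have h1 : MDifferentiableAt 𝓘(ℝ, EQ) 𝓘(ℝ, EQ) φ.symm y :=
      (contMDiffOn_extChartAt_symm (n := ∞) q |>.mdifferentiableOn
        (by simp) y (hb hy)).mdifferentiableAt
        (Filter.mem_of_superset (Metric.isOpen_ball.mem_nhds hy) hb)
    have h2 := ((f.contMDiff.mdifferentiable (by simp) (φ.symm y)).hasMFDerivAt).comp y
      h1.hasMFDerivAt
    rw [hf] at h2
    have h3 := hasMFDerivAt_iff_hasFDerivAt.1 h2
    exact h3.congr_fderiv (ContinuousLinearMap.zero_comp _)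
  have hc : ∀ y ∈ Metric.ball (φ q) ε, (f ∘ φ.symm) y = (f ∘ φ.symm) (φ q) := fun y hy =>
    Metric.isOpen_ball.is_const_of_fderiv_eq_zero (𝕜 := ℝ) (convex_ball (φ q) ε).isPreconnected
      (fun z hz => (hd z hz).differentiableAt.differentiableWithinAt)
      (fun z hz => (hd z hz).fderiv) hy (Metric.mem_ball_self hε)
  filter_upwards [extChartAt_source_mem_nhds (I := 𝓘(ℝ, EQ)) q,
    (continuousAt_extChartAt (I := 𝓘(ℝ, EQ)) q).preimage_mem_nhds (Metric.ball_mem_nhds _ hε)]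
    with y hy hy'
  have := hc _ hy'
  simp only [Function.comp] at this
  rwa [φ.left_inv hy, φ.left_inv (mem_extChartAt_source q)] at this

/-- The kernel of the differential of `f` at each point contains the iterated brackets, which span
the tangent space. -/
lemma CompletelyNonholonomic.exists_eq_const [CompleteSpace EQ] [PreconnectedSpace Q] [Nonempty Q]
    {D : ∀ q : Q, Submodule ℝ (TangentSpace 𝓘(ℝ, EQ) q)} (hD : CompletelyNonholonomic D)
    (f : C^∞⟮𝓘(ℝ, EQ), Q; ℝ⟯) (hf : ∀ q, ∀ v ∈ D q, dirDeriv f q v = 0) :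
    ∃ k : ℝ, ∀ q, f q = k := by
  have h : ∀ q, mfderiv 𝓘(ℝ, EQ) 𝓘(ℝ, ℝ) f q = 0 := by
    intro q
    let L : TangentSpace 𝓘(ℝ, EQ) q →ₗ[ℝ] ℝ := (mfderiv 𝓘(ℝ, EQ) 𝓘(ℝ, ℝ) f q).toLinearMap
    have h1 : Submodule.span ℝ {v | ∃ Y, IteratedBracket D Y ∧ Y q = v}
        ≤ LinearMap.ker L := by
      rw [Submodule.span_le]
      rintro _ ⟨Y, hY, rfl⟩
      exact (hY.contMDiff_and_dirDeriv_eq_zero f hf).2 q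
    rw [hD q] at h1
    exact ContinuousLinearMap.ext fun v => h1 (Submodule.mem_top (x := v))
  obtain ⟨q₀⟩ := ‹Nonempty Q›
  exact ⟨f q₀, fun q =>
    (isLocallyConstant_of_mfderiv_eq_zero f h).apply_eq_of_preconnectedSpace _ _⟩

end Nonholonomic

/-! ### Lifting integral curves from `Q` to `U*` -/

section HamiltonJacobi

namespace AffineSystem

variable {EQ : Type*} [NormedAddCommGroup EQ] [NormedSpace ℝ EQ] [FiniteDimensional ℝ EQ]
  {Q : Type*} [TopologicalSpace Q] [ChartedSpace EQ Q] [IsManifold 𝓘(ℝ, EQ) ∞ Q] [T2Space Q]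
  {F : Type*} [NormedAddCommGroup F] [NormedSpace ℝ F]
  {E : Q → Type*} [TopologicalSpace (TotalSpace F E)] [∀ q, TopologicalSpace (E q)]
  [∀ q, AddCommGroup (E q)] [∀ q, Module ℝ (E q)] [FiberBundle F E] [VectorBundle ℝ F E]
  [∀ q, IsTopologicalAddGroup (E q)] [∀ q, ContinuousConstSMul ℝ (E q)]
  {FU : Type*} [NormedAddCommGroup FU] [NormedSpace ℝ FU] [FiniteDimensional ℝ FU]
  {U : Q → Type*} [TopologicalSpace (TotalSpace FU U)] [∀ q, TopologicalSpace (U q)]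
  [∀ q, AddCommGroup (U q)] [∀ q, Module ℝ (U q)] [FiberBundle FU U] [VectorBundle ℝ FU U]
  [ContMDiffVectorBundle ∞ FU U 𝓘(ℝ, EQ)]
  (M : AffineSystem EQ F E FU U) (A : SkewAlgebroid EQ F E)
  {β : Cₛ^∞⟮𝓘(ℝ, EQ); ℝ × FU →L[ℝ] ℝ, fun q => ℝ × U q →L[ℝ] ℝ⟯}

/-- By the chain rule the lifted curve has the velocity given by the tangential part of `R_h`; only
the vertical part can obstruct the Hamilton equations. -/
lemma hasMFDerivAt_muSection_comp (hβ : (M.algebroidTilde A).IsCocycle β) {c : ℝ → Q} {t : ℝ}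
    (hc : HasMFDerivAt 𝓘(ℝ, ℝ) 𝓘(ℝ, EQ) c t
      ((1 : ℝ →L[ℝ] ℝ).smulRight (M.baseVectorField A (fun q => muFib q (β q)) (c t)))) :
    HasMFDerivAt 𝓘(ℝ, ℝ) (𝓘(ℝ, EQ).prod 𝓘(ℝ, FU →L[ℝ] ℝ))
      (fun t => (⟨c t, muFib (c t) (β (c t))⟩ : DualU FU U)) t
      ((1 : ℝ →L[ℝ] ℝ).smulRight (mfderiv 𝓘(ℝ, EQ) (𝓘(ℝ, EQ).prod 𝓘(ℝ, FU →L[ℝ] ℝ))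
          (fun q => (⟨q, muFib q (β q)⟩ : DualU FU U)) (c t)
          (A.anchor.toFun (c t) (M.velocity β (c t))))) := by
  rw [M.baseVectorField_cocycle A hβ] at hc
  have h := ((muSection β).mdifferentiable (c t)).hasMFDerivAt.comp t hc
  let D : EQ →L[ℝ] EQ × (FU →L[ℝ] ℝ) := mfderiv 𝓘(ℝ, EQ) (𝓘(ℝ, EQ).prod 𝓘(ℝ, FU →L[ℝ] ℝ))
          (fun q => (⟨q, muFib q (β q)⟩ : DualU FU U)) (c t)
  let v : EQ := A.anchor.toFun (c t) (M.velocity β (c t))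
  have h1 : D ∘L (1 : ℝ →L[ℝ] ℝ).smulRight v = (1 : ℝ →L[ℝ] ℝ).smulRight (D v) := by
    ext <;> simp
  exact h1 ▸ h

/-- Injectivity of the vertical lift, seen by testing on the linear function of a section through
`u`. -/
lemma vertLift_eq_zero {q : Q} {a η : U q →L[ℝ] ℝ}
    (h : (vertLift (F := FU →L[ℝ] ℝ) (E := fun q => U q →L[ℝ] ℝ) ⟨q, a⟩ η :
      TangentSpace (𝓘(ℝ, EQ).prod 𝓘(ℝ, FU →L[ℝ] ℝ)) (⟨q, a⟩ : DualU FU U)) = 0) (u : U q) :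
    η u = 0 := by
  obtain ⟨σ, rfl⟩ := exists_section_eq (EQ := EQ) (F := FU) q u
  have h1 := mfderiv_linBasic_vertLift σ (0 : C^∞⟮𝓘(ℝ, EQ), Q; ℝ⟯) q a η
  rw [h] at h1
  exact h1.symm.trans (map_zero (mfderiv (𝓘(ℝ, EQ).prod 𝓘(ℝ, FU →L[ℝ] ℝ)) 𝓘(ℝ, ℝ)
    (linBasic σ (0 : C^∞⟮𝓘(ℝ, EQ), Q; ℝ⟯)) (⟨q, a⟩ : DualU FU U)))

/-- For a cocycle `β`, the curves `μ ∘ β ∘ c` are solutions of the Hamilton equations iff the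
differential of `H ∘ μ ∘ β + β(1, X₀)` vanishes on `ρ(U)`. -/
lemma integralCurves_iff (hβ : (M.algebroidTilde A).IsCocycle β) :
    (∀ (J : Set ℝ) (c : ℝ → Q), IsOpen J → J.OrdConnected →
        IsMIntegralCurveOn c (M.baseVectorField A fun q => muFib q (β q)) J →
        IsMIntegralCurveOn (fun t => (⟨c t, muFib (c t) (β (c t))⟩ : DualU FU U))
          (M.hamVectorField A) J) ↔
      ∀ q u, dirDeriv (M.energy β) q (A.anchor.toFun q (M.sub.incl.toFun q u)) = 0 := by
  constructor
  · intro h q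
    have hX : ContMDiff 𝓘(ℝ, EQ) 𝓘(ℝ, EQ).tangent ∞
        (fun q => (⟨q, M.baseVectorField A (fun q => muFib q (β q)) q⟩ :
          TangentBundle 𝓘(ℝ, EQ) Q)) := by
      simp only [M.baseVectorField_cocycle A hβ]
      exact (A.anchor.mapSection (M.velocity β)).contMDiff
    have : IsManifold 𝓘(ℝ, EQ) 1 Q := IsManifold.of_le (n := ∞) (by norm_cast)
    -- The field is the anchor image of a smooth section, so an integral curve starts at any given
    -- `q`; statement 1 is then used on a small interval around `0`.
    obtain ⟨c, rfl, hc⟩ := exists_isMIntegralCurveAt_of_contMDiffAt_boundaryless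
      (I := 𝓘(ℝ, EQ)) (v := M.baseVectorField A fun q => muFib q (β q)) 0
      ((hX q).of_le (by norm_cast))
    obtain ⟨ε, hε, hcε⟩ := isMIntegralCurveAt_iff'.1 hc
    have h0 : Metric.ball (0 : ℝ) ε ∈ nhds (0 : ℝ) := Metric.ball_mem_nhds _ hε
    have h1 := (h _ c Metric.isOpen_ball (convex_ball (0 : ℝ) ε).ordConnected hcε 0
      (Metric.mem_ball_self hε)).hasMFDerivAt h0
    have h2 := M.hasMFDerivAt_muSection_comp A hβ
      ((hcε 0 (Metric.mem_ball_self hε)).hasMFDerivAt h0)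
    obtain ⟨η, hη⟩ := exists_continuousLinearMap_eq FU
      ((mfderiv 𝓘(ℝ, EQ) 𝓘(ℝ, ℝ) (M.energy β) (c 0)).toLinearMap ∘ₗ A.anchor.toFun (c 0)
        ∘ₗ M.sub.incl.toFun (c 0))
    -- Two expressions for the velocity of the lifted curve at `0`: the value of `R_h`, and its
    -- tangential part alone. Their difference is the vertical lift of `η`, which therefore
    -- vanishes.
    have h3 := congrArg (fun L : ℝ →L[ℝ] EQ × (FU →L[ℝ] ℝ) => L 1) (hasMFDerivAt_unique h1 h2)
    have h4 := ((one_smul ℝ _).symm.trans h3).trans (one_smul ℝ _)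
    rw [M.hamVectorField_cocycle A hβ hη] at h4
    have h5 := vertLift_eq_zero (sub_eq_self.1 h4)
    exact fun u => (hη u).symm.trans (h5 u)
  · intro h J c hJ _ hc t ht
    have h1 := M.hasMFDerivAt_muSection_comp A hβ ((hc t ht).hasMFDerivAt (hJ.mem_nhds ht))
    -- The energy is annihilated by `ρ(U)`, so `η = 0` is the admissible covector and `R_h` is
    -- tangent to the section `μ ∘ β`.
    have h2 := M.hamVectorField_cocycle A hβ (q := c t) (η := 0) fun u => (h (c t) u).symm
    rw [map_zero, sub_zero] at h2
    have h3 := h1.hasMFDerivWithinAt (s := J)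
    rw [← h2] at h3
    exact h3

end AffineSystem

end HamiltonJacobi

end AffineHJ

end

theorem corollary4p7
    {EQ : Type*} [NormedAddCommGroup EQ] [NormedSpace ℝ EQ] [FiniteDimensional ℝ EQ]
    {Q : Type*} [TopologicalSpace Q] [ChartedSpace EQ Q] [IsManifold 𝓘(ℝ, EQ) ∞ Q]
    [T2Space Q] [SecondCountableTopology Q] [ConnectedSpace Q]
    {F : Type*} [NormedAddCommGroup F] [NormedSpace ℝ F] [FiniteDimensional ℝ F]
    {E : Q → Type*} [TopologicalSpace (TotalSpace F E)] [∀ q, TopologicalSpace (E q)]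
    [∀ q, AddCommGroup (E q)] [∀ q, Module ℝ (E q)]
    [∀ q, IsTopologicalAddGroup (E q)] [∀ q, ContinuousConstSMul ℝ (E q)]
    [FiberBundle F E] [VectorBundle ℝ F E] [ContMDiffVectorBundle ∞ F E 𝓘(ℝ, EQ)]
    {FU : Type*} [NormedAddCommGroup FU] [NormedSpace ℝ FU] [FiniteDimensional ℝ FU]
    {U : Q → Type*} [TopologicalSpace (TotalSpace FU U)] [∀ q, TopologicalSpace (U q)]
    [∀ q, AddCommGroup (U q)] [∀ q, Module ℝ (U q)]
    [FiberBundle FU U] [VectorBundle ℝ FU U] [ContMDiffVectorBundle ∞ FU U 𝓘(ℝ, EQ)]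
    (A : AffineHJ.LieAlgebroid EQ F E) (M : AffineHJ.AffineSystem EQ F E FU U)
    (hU : AffineHJ.CompletelyNonholonomic (M.algebroidU A.toSkewAlgebroid).distribution)
    (β : Cₛ^∞⟮𝓘(ℝ, EQ); ℝ × FU →L[ℝ] ℝ, fun q => ℝ × U q →L[ℝ] ℝ⟯)
    (hβ : (M.algebroidTilde A.toSkewAlgebroid).IsCocycle β) :
    (∀ (J : Set ℝ) (c : ℝ → Q), IsOpen J → J.OrdConnected →
        IsMIntegralCurveOn c
          (M.baseVectorField A.toSkewAlgebroid fun q => AffineHJ.AffineSystem.muFib q (β q)) J →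
        IsMIntegralCurveOn
          (fun t => (⟨c t, AffineHJ.AffineSystem.muFib (c t) (β (c t))⟩ :
            AffineHJ.AffineSystem.DualU FU U))
          (M.hamVectorField A.toSkewAlgebroid) J) ↔
      ∃ k : ℝ, ∀ q : Q,
        M.hamiltonian ⟨q, AffineHJ.AffineSystem.muFib q (β q)⟩
          + β q (AffineHJ.AffineSystem.oneX₀ q) = k := by
  refine (M.integralCurves_iff A.toSkewAlgebroid hβ).trans ⟨fun h => ?_, ?_⟩
  -- A vector of the distribution at `q` is by definition `ρ(u)` for some `u` in `U_q`.
  · exact hU.exists_eq_const (M.energy β) (by rintro q _ ⟨u, rfl⟩; exact h q u)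
  · rintro ⟨k, hk⟩ q u
    have hE : (M.energy β : Q → ℝ) = fun _ => k := funext hk
    rw [hE]
    exact congrArg (fun L : EQ →L[ℝ] ℝ => L _)
      (mfderiv_const (I := 𝓘(ℝ, EQ)) (I' := 𝓘(ℝ, ℝ)) (c := k) (x := q))
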